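/- Let $D,G\subset\mathbb C^n$ be domains (non-empty connected open sets). In each of the following two cases there is no proper holomorphic map $D\to G$ and no proper holomorphic map $G\to D$. 1. There are a domain $D'\subset\mathbb C^n$ and a plurisubharmonic function $u:D'\to[-\infty,\infty)$ such that $D\subset\{z\in D':u(z)<0\}$ and $u$ is not constant on $D$; and $G=\mathbb C^n\setminus E$ for some pluripolar set $E\subset\mathbb C^n$ (that is, every point $a\in E$ has a connected open neighbourhood $V$ with a plurisubharmonic function $w\not\equiv-\infty$ on $V$ such that $w=-\infty$ on $E\cap V$). 2. $D$ is hyperconvex, i.e. there is a plurisubharmonic function $u:D\to[-\infty,0)$ such that for every real $c<0$ the set $\{z\in D:u(z)<c\}$ is relatively compact in $D$; and $G$ is not Brody hyperbolic, i.e. there is a non-constant holomorphic map $\mathbb C\to G$. -/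

import Mathlib

open MeasureTheory Set

namespace SCV

/-- The space `ℂⁿ` with its Euclidean norm. -/
abbrev Cn (n : ℕ) : Type := EuclideanSpace ℂ (Fin n)

/-- A domain in `ℂⁿ`: a non-empty connected open set. -/
def IsCnDomain {n : ℕ} (D : Set (Cn n)) : Prop :=
  IsOpen D ∧ IsConnected D

/-- The mean value `(1 / 2π) ∫₀^{2π} u (c + r e^{iθ}) dθ` of an extended real function, as the
difference of the means of its positive and negative parts. If `u` is upper semicontinuous and
`< ∞` on the circle, the first of these is finite and the value is the Lebesgue integral
in `[-∞, ∞)`. -/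
noncomputable def circleMean (u : ℂ → EReal) (c : ℂ) (r : ℝ) : EReal :=
  (((∫⁻ θ in Ioc (0 : ℝ) (2 * Real.pi), (u (circleMap c r θ)).toENNReal)
      / ENNReal.ofReal (2 * Real.pi) : ENNReal) : EReal)
  - (((∫⁻ θ in Ioc (0 : ℝ) (2 * Real.pi), (-u (circleMap c r θ)).toENNReal)
      / ENNReal.ofReal (2 * Real.pi) : ENNReal) : EReal)

/-- `u` is subharmonic on the open set `U ⊆ ℂ`: it takes values in `[-∞, ∞)`, is upper
semicontinuous, and satisfies the sub-mean value inequality on every closed disc in `U`.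
The function `-∞` is allowed. -/
def SubharmonicOn (u : ℂ → EReal) (U : Set ℂ) : Prop :=
  UpperSemicontinuousOn u U ∧ (∀ z ∈ U, u z < ⊤) ∧
    ∀ (c : ℂ) (r : ℝ), 0 < r → Metric.closedBall c r ⊆ U → u c ≤ circleMean u c r

/-- `u` is plurisubharmonic on the open set `Ω ⊆ ℂⁿ`: it takes values in `[-∞, ∞)`, is upper
semicontinuous, and is subharmonic along every complex line. The function `-∞` is allowed. -/
def PSHOn {n : ℕ} (u : Cn n → EReal) (Ω : Set (Cn n)) : Prop :=
  UpperSemicontinuousOn u Ω ∧ (∀ z ∈ Ω, u z < ⊤) ∧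
    ∀ a b : Cn n, SubharmonicOn (fun ζ : ℂ => u (a + ζ • b)) {ζ : ℂ | a + ζ • b ∈ Ω}

/-- `E ⊆ ℂⁿ` is pluripolar: near each of its points it is contained in the `-∞` set of a
plurisubharmonic function that is not identically `-∞`. -/
def IsPluripolar {n : ℕ} (E : Set (Cn n)) : Prop :=
  ∀ a ∈ E, ∃ V : Set (Cn n), IsCnDomain V ∧ a ∈ V ∧
    ∃ w : Cn n → EReal, PSHOn w V ∧ (∃ z ∈ V, w z ≠ ⊥) ∧ ∀ z ∈ E ∩ V, w z = ⊥

/-- `D` is hyperconvex: it has a negative plurisubharmonic exhaustion function, that is, a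
plurisubharmonic `u < 0` on `D` such that for every real `c < 0` the set `{u < c}` is relatively
compact in `D`. -/
def IsHyperconvex {n : ℕ} (D : Set (Cn n)) : Prop :=
  ∃ u : Cn n → EReal, PSHOn u D ∧ (∀ z ∈ D, u z < 0) ∧
    ∀ c : ℝ, c < 0 → ∃ K : Set (Cn n), IsCompact K ∧ K ⊆ D ∧ {z ∈ D | u z < (c : EReal)} ⊆ K

/-- `G` is Brody hyperbolic: every holomorphic map from `ℂ` to `G` is constant. -/
def IsBrodyHyperbolic {n : ℕ} (G : Set (Cn n)) : Prop :=
  ∀ ψ : ℂ → Cn n, Differentiable ℂ ψ → (∀ ζ, ψ ζ ∈ G) → ∀ ζ ξ, ψ ζ = ψ ξ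

/-- `f` restricts to a proper holomorphic map from the open set `D` to the open set `G`. -/
def IsProperHolomorphic {n : ℕ} (f : Cn n → Cn n) (D G : Set (Cn n)) : Prop :=
  DifferentiableOn ℂ f D ∧ ∃ h : MapsTo f D G, IsProperMap (h.restrict f D G)

end SCV

/-! Push a nonpositive plurisubharmonic function `u` on the source of a proper map `f` forward to `v
w`, the supremum of `u` over the fibre of `w` (`fibreSup`). Fibres are compact, so the supremum over
a non-empty fibre is attained and `v` is upper semicontinuous. The central fact is that `v` is
subharmonic along every holomorphic disc in the target (`ProperOn.hasSubmean_fibreSup`). It is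
combined with a Liouville theorem: a nonpositive subharmonic function off a closed thin subset of
`ℂ` is constant (`NonposSubharmonicOff.eq`).

Case 1: almost every complex line through a point of `G` meets `E` in a thin set, and two points of
`G` are joined by two such lines through a third point. For `f : D → G` this makes `v` constant on
`f '' D`, so `u` attains its maximum on `D` and is constant by the strong maximum principle
(`PSHOn.eq_of_le`). For `g : G → D` the same argument, with the identity of `D` as the proper map,
makes `u ∘ g` constant, and `g` is onto (`ProperOn.surjOn`).

Case 2: along an entire curve in the target, `v` is a negative constant, so the curve stays in the
image of a relatively compact sublevel set and is bounded, hence constant. For `g : G → D` this is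
applied to `g ∘ ψ`, and properness of `g` brings the compact set back to `G`.

Subharmonicity of the pushforward is shown without branched coverings, in the viscosity sense
(`NoTouch`). If a strictly superharmonic function touched `v ∘ ψ` from above, then `u z` minus it,
minus a large multiple of `‖f z - ψ ζ‖ ^ 2`, plus `δ log |jac f z|`, would have an interior maximum
in `(z, ζ)` at a noncritical `z`. There one can move along a direction `a` with `f'(z) a = ψ'(ζ)`:
the penalty changes only at higher order in the mean, while the strictness costs a definite second
order term. A similar maximum argument shows that `jac f` is not identically zero. Comparison with
real parts of entire functions turns `NoTouch` into the sub-mean inequality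
(`hasSubmean_of_noTouch`). -/

namespace SCV
open Filter Topology Metric Real InnerProductSpace

/-! ### Sub-mean value inequality on a single circle -/

/-- The value of `s` at the centre is at most the mean over the circle of an integrable minorant
of `s`. -/
def HasSubmean (s : ℂ → EReal) (c : ℂ) (r : ℝ) : Prop :=
  ∃ g : ℂ → ℝ, CircleIntegrable g c r ∧
    (∀ᵐ θ ∂volume.restrict (Ioc 0 (2 * π)), (g (circleMap c r θ) : EReal) ≤ s (circleMap c r θ)) ∧
    s c ≤ ((circleAverage g c r : ℝ) : EReal)

theorem UpperSemicontinuousOn.comp_circleMap {s : ℂ → EReal} {c : ℂ} {r : ℝ} (hr : 0 ≤ r)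
    (h : UpperSemicontinuousOn s (sphere c r)) :
    UpperSemicontinuous fun θ => s (circleMap c r θ) := by
  have h2 : UpperSemicontinuousOn (s ∘ circleMap c r) univ :=
    h.comp (continuous_circleMap c r).continuousOn (fun θ _ => circleMap_mem_sphere c hr θ)
  exact upperSemicontinuousOn_univ_iff.1 h2

theorem two_pi_ennreal_ne_zero : ENNReal.ofReal (2 * π) ≠ 0 := by
  simpa using two_pi_pos

theorem coe_ennreal_div_two_pi {x : ENNReal} (hx : x ≠ ⊤) :
    ((x / ENNReal.ofReal (2 * π) : ENNReal) : EReal) = (((2 * π)⁻¹ * x.toReal : ℝ) : EReal) := by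
  have h : x / ENNReal.ofReal (2 * π) ≠ ⊤ := ENNReal.div_ne_top hx two_pi_ennreal_ne_zero
  rw [← EReal.coe_ennreal_toReal h, ENNReal.toReal_div, ENNReal.toReal_ofReal two_pi_pos.le,
    div_eq_inv_mul]

theorem exists_real_bound {X : Type*} [TopologicalSpace X] {s : X → EReal} {K : Set X}
    (hK : IsCompact K) (hs : UpperSemicontinuousOn s K) (htop : ∀ z ∈ K, s z < ⊤) :
    ∃ M : ℝ, ∀ z ∈ K, s z ≤ (M : EReal) := by
  rcases K.eq_empty_or_nonempty with rfl | hne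
  · exact ⟨0, by simp⟩
  obtain ⟨a, ha, hmax⟩ := hs.exists_isMaxOn hne hK
  by_cases hb : s a = ⊥
  · refine ⟨0, fun z hz => ?_⟩
    have : s z ≤ s a := hmax hz
    rw [hb] at this
    exact this.trans bot_le
  · refine ⟨(s a).toReal, fun z hz => ?_⟩
    rw [EReal.coe_toReal (htop a ha).ne hb]
    exact hmax hz

theorem circleIntegrable_iff_integrableOn {g : ℂ → ℝ} {c : ℂ} {r : ℝ} :
    CircleIntegrable g c r ↔ IntegrableOn (fun θ => g (circleMap c r θ)) (Ioc 0 (2 * π)) := by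
  unfold CircleIntegrable
  rw [intervalIntegrable_iff_integrableOn_Ioc_of_le two_pi_pos.le]

theorem circleAverage_eq_setIntegral (g : ℂ → ℝ) (c : ℂ) (r : ℝ) :
    circleAverage g c r = (2 * π)⁻¹ * ∫ θ in Ioc 0 (2 * π), g (circleMap c r θ) := by
  rw [circleAverage_def, intervalIntegral.integral_of_le two_pi_pos.le, smul_eq_mul]

/-- Upper semicontinuity bounds the positive part, and a finite value at the centre forces the
negative part to have finite integral. Hence the real-valued version of `s` itself serves as the
integrable minorant. -/
theorem SubharmonicOn.hasSubmean {s : ℂ → EReal} {U : Set ℂ} (hs : SubharmonicOn s U) {c : ℂ}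
    {r : ℝ} (hr : 0 < r) (hU : closedBall c r ⊆ U) (hc : s c ≠ ⊥) : HasSubmean s c r := by
  obtain ⟨husc, htop, hmean⟩ := hs
  have hsph : sphere c r ⊆ U := sphere_subset_closedBall.trans hU
  have hmeas : Measurable fun θ => s (circleMap c r θ) :=
    (UpperSemicontinuousOn.comp_circleMap hr.le (husc.mono hsph)).measurable
  obtain ⟨M, hM⟩ := exists_real_bound (isCompact_sphere c r) (husc.mono hsph)
    (fun z hz => htop z (hsph hz))
  have hmem : ∀ θ, circleMap c r θ ∈ sphere c r := fun θ => circleMap_mem_sphere c hr.le θ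
  set P : ℝ → ENNReal := fun θ => (s (circleMap c r θ)).toENNReal with hP
  set N : ℝ → ENNReal := fun θ => (-s (circleMap c r θ)).toENNReal with hN
  have hPm : Measurable P := hmeas.ereal_toENNReal
  have hNm : Measurable N := hmeas.neg.ereal_toENNReal
  have hPfin : (∫⁻ θ in Ioc (0 : ℝ) (2 * π), P θ) ≠ ⊤ := by
    have h1 : (∫⁻ θ in Ioc (0 : ℝ) (2 * π), P θ) ≤
        ∫⁻ _ in Ioc (0 : ℝ) (2 * π), ENNReal.ofReal M := by
      apply lintegral_mono
      intro θ
      have := EReal.toENNReal_le_toENNReal (hM _ (hmem θ))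
      simpa [hP] using this
    refine ne_top_of_le_ne_top ?_ h1
    rw [setLIntegral_const]
    exact ENNReal.mul_ne_top ENNReal.ofReal_ne_top measure_Ioc_lt_top.ne
  have hm := hmean c r hr hU
  unfold circleMean at hm
  have hNfin : (∫⁻ θ in Ioc (0 : ℝ) (2 * π), N θ) ≠ ⊤ := by
    intro h
    change s c ≤ (((∫⁻ θ in Ioc (0 : ℝ) (2 * π), P θ) / _ : ENNReal) : EReal)
      - (((∫⁻ θ in Ioc (0 : ℝ) (2 * π), N θ) / _ : ENNReal) : EReal) at hm
    rw [h, ENNReal.top_div_of_ne_top ENNReal.ofReal_ne_top] at hm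
    simp at hm
    exact hc hm
  change s c ≤ (((∫⁻ θ in Ioc (0 : ℝ) (2 * π), P θ) / _ : ENNReal) : EReal)
      - (((∫⁻ θ in Ioc (0 : ℝ) (2 * π), N θ) / _ : ENNReal) : EReal) at hm
  rw [coe_ennreal_div_two_pi hPfin, coe_ennreal_div_two_pi hNfin, ← EReal.coe_sub, ← mul_sub] at hm
  have hNae := ae_lt_top hNm hNfin
  have hreal : ∀ θ, (s (circleMap c r θ)).toReal = (P θ).toReal - (N θ).toReal := by
    intro θ
    simp only [hP, hN]
    induction s (circleMap c r θ) with
    | bot => simp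
    | top => simp
    | coe x =>
      rw [← EReal.coe_neg]
      simp only [EReal.toReal_coe, EReal.toENNReal_of_ne_top (EReal.coe_ne_top _)]
      rw [ENNReal.toReal_ofReal', ENNReal.toReal_ofReal']
      rcases le_total 0 x with h | h
      · simp [h]
      · simp [h]
  have hPi := integrable_toReal_of_lintegral_ne_top hPm.aemeasurable hPfin
  have hNi := integrable_toReal_of_lintegral_ne_top hNm.aemeasurable hNfin
  refine ⟨fun z => (s z).toReal, ?_, ?_, ?_⟩
  · rw [circleIntegrable_iff_integrableOn]
    simp only [hreal]
    exact hPi.sub hNi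
  · filter_upwards [hNae] with θ hθ
    rw [EReal.coe_toReal (htop _ (hsph (hmem θ))).ne]
    intro hb
    simp [hN, hb] at hθ
  · rw [circleAverage_eq_setIntegral]
    simp only [hreal]
    rw [integral_sub hPi hNi, integral_toReal hPm.aemeasurable (ae_lt_top hPm hPfin),
      integral_toReal hNm.aemeasurable hNae]
    exact hm

theorem circleAverage_mono_ae {g T : ℂ → ℝ} {c : ℂ} {r : ℝ} (hg : CircleIntegrable g c r)
    (hT : CircleIntegrable T c r)
    (h : ∀ᵐ θ ∂volume.restrict (Ioc 0 (2 * π)), g (circleMap c r θ) ≤ T (circleMap c r θ)) :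
    circleAverage g c r ≤ circleAverage T c r := by
  rw [circleAverage_eq_setIntegral, circleAverage_eq_setIntegral]
  rw [circleIntegrable_iff_integrableOn] at hg hT
  have := two_pi_pos
  gcongr ?_ * ?_
  exact integral_mono_ae hg hT h

theorem HasSubmean.le_circleAverage {s : ℂ → EReal} {c : ℂ} {r : ℝ} (hr : 0 ≤ r)
    (h : HasSubmean s c r) {T : ℂ → ℝ} (hT : CircleIntegrable T c r)
    (hsT : ∀ z ∈ sphere c r, s z ≤ (T z : EReal)) : s c ≤ ((circleAverage T c r : ℝ) : EReal) := by
  obtain ⟨g, hg, hgs, hc⟩ := h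
  refine hc.trans (EReal.coe_le_coe_iff.2 (circleAverage_mono_ae hg hT ?_))
  filter_upwards [hgs] with θ hθ
  exact EReal.coe_le_coe_iff.1 (hθ.trans (hsT _ (circleMap_mem_sphere c hr θ)))

/-- The strong maximum principle on one circle. -/
theorem HasSubmean.eq_of_le {s : ℂ → EReal} {c : ℂ} {r : ℝ} (hr : 0 ≤ r)
    (h : HasSubmean s c r) (husc : UpperSemicontinuousOn s (sphere c r)) (hbot : s c ≠ ⊥)
    (htop : s c ≠ ⊤) (hle : ∀ z ∈ sphere c r, s z ≤ s c) : ∀ z ∈ sphere c r, s z = s c := by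
  obtain ⟨g, hg, hgs, hc⟩ := h
  set m := (s c).toReal with hm
  have hsm : s c = (m : EReal) := (EReal.coe_toReal htop hbot).symm
  rw [hsm] at hc hle ⊢
  rw [EReal.coe_le_coe_iff] at hc
  have hgi := circleIntegrable_iff_integrableOn.1 hg
  have hgm : ∀ᵐ θ ∂volume.restrict (Ioc 0 (2 * π)), g (circleMap c r θ) ≤ m := by
    filter_upwards [hgs] with θ hθ
    exact EReal.coe_le_coe_iff.1 (hθ.trans (hle _ (circleMap_mem_sphere c hr θ)))
  have hci : IntegrableOn (fun _ : ℝ => m) (Ioc 0 (2 * π)) :=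
    integrableOn_const measure_Ioc_lt_top.ne
  -- The integrand is nonnegative almost everywhere, so `g = m`, and hence `s ≥ m`, almost
  -- everywhere on the circle; semicontinuity then upgrades this to every point, as `{s < m}` is
  -- open.
  have hint : ∫ θ in Ioc 0 (2 * π), (m - g (circleMap c r θ)) ≤ 0 := by
    rw [integral_sub hci hgi]
    rw [circleAverage_eq_setIntegral] at hc
    have h2 : ∫ _ in Ioc 0 (2 * π), m = (2 * π) * m := by
      simp [two_pi_pos.le]
    rw [h2]
    have h3 := mul_le_mul_of_nonneg_left hc two_pi_pos.le
    rw [← mul_assoc, mul_inv_cancel₀ two_pi_pos.ne', one_mul] at h3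
    linarith
  have hnn : 0 ≤ᵐ[volume.restrict (Ioc 0 (2 * π))] fun θ => m - g (circleMap c r θ) := by
    filter_upwards [hgm] with θ hθ
    simpa using hθ
  have hzero := (integral_eq_zero_iff_of_nonneg_ae hnn (hci.sub hgi)).1
    (le_antisymm hint (integral_nonneg_of_ae hnn))
  have hsae : ∀ᵐ θ ∂volume.restrict (Ioc 0 (2 * π)), (m : EReal) ≤ s (circleMap c r θ) := by
    filter_upwards [hzero, hgs] with θ h1 h2
    have : g (circleMap c r θ) = m := by
      simp at h1
      linarith
    rwa [this] at h2
  have hu := UpperSemicontinuousOn.comp_circleMap hr husc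
  intro z hz
  refine le_antisymm (hle z hz) ?_
  by_contra hlt
  rw [not_le] at hlt
  rw [← abs_of_nonneg hr, ← image_circleMap_Ioc] at hz
  obtain ⟨θ₀, hθ₀, rfl⟩ := hz
  set O := {θ : ℝ | s (circleMap c r θ) < m}
  have hO : IsOpen O := hu.isOpen_preimage m
  have hne : (O ∩ Ioo 0 (2 * π)).Nonempty := by
    have : θ₀ ∈ closure (Ioo 0 (2 * π)) := by
      rw [closure_Ioo two_pi_pos.ne]
      exact Ioc_subset_Icc_self hθ₀
    exact mem_closure_iff.1 this O hO hlt
  have hpos := (hO.inter isOpen_Ioo).measure_pos volume hne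
  rw [ae_restrict_iff' measurableSet_Ioc] at hsae
  refine hpos.ne' (measure_mono_null ?_ hsae)
  rintro θ ⟨h1, h2⟩
  simp only [mem_compl_iff, mem_ofPred_eq, not_forall, not_le]
  exact ⟨Ioo_subset_Ioc_self h2, h1⟩

end SCV

/-! ### From the touching criterion to the sub-mean inequality -/

namespace SCV
open Filter Topology Metric Real InnerProductSpace

/-- An upper semicontinuous function plus a continuous one attains its maximum on a compact set. -/
theorem exists_max_add {X : Type*} [TopologicalSpace X] {u : X → EReal} {K : Set X}
    (hK : IsCompact K) (hu : UpperSemicontinuousOn u K) (htop : ∀ z ∈ K, u z < ⊤) {T : X → ℝ}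
    (hT : ContinuousOn T K) {y : X} (hy : y ∈ K) (hyb : u y ≠ ⊥) :
    ∃ x ∈ K, ∃ m : ℝ, u x = m ∧ ∀ z ∈ K, u z ≤ ((m + T x - T z : ℝ) : EReal) := by
  have hsum : UpperSemicontinuousOn (fun z => u z + (T z : EReal)) K := by
    refine hu.add' ?_ ?_
    · exact (continuous_coe_real_ereal.comp_continuousOn hT).upperSemicontinuousOn
    · intro x _
      exact EReal.continuousAt_add (Or.inr (EReal.coe_ne_bot _)) (Or.inr (EReal.coe_ne_top _))
  obtain ⟨x, hx, hmax⟩ := hsum.exists_isMaxOn ⟨y, hy⟩ hK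
  have hxb : u x ≠ ⊥ := by
    intro h
    have h1 : u y + (T y : EReal) ≤ u x + (T x : EReal) := hmax hy
    rw [h, EReal.bot_add, le_bot_iff, EReal.add_eq_bot_iff] at h1
    rcases h1 with h1 | h1
    · exact hyb h1
    · exact EReal.coe_ne_bot _ h1
  refine ⟨x, hx, (u x).toReal, (EReal.coe_toReal (htop x hx).ne hxb).symm, fun z hz => ?_⟩
  have h1 : u z + (T z : EReal) ≤ u x + (T x : EReal) := hmax hz
  rw [← EReal.coe_toReal (htop x hx).ne hxb, ← EReal.coe_add] at h1
  by_cases hzb : u z = ⊥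
  · rw [hzb]; exact bot_le
  rw [← EReal.coe_toReal (htop z hz).ne hzb, ← EReal.coe_add, EReal.coe_le_coe_iff] at h1
  rw [← EReal.coe_toReal (htop z hz).ne hzb, EReal.coe_le_coe_iff]
  linarith

theorem fourier_eq_pow {T : ℝ} (n : ℕ) (x : AddCircle T) :
    fourier (n : ℤ) x = (fourier 1 x) ^ n := by
  induction n with
  | zero => simp
  | succ k ih => rw [Nat.cast_succ, fourier_add, ih, pow_succ]

/-- Conjugation leaves real parts unchanged and turns negative frequencies into positive ones, that
is, into polynomials in `(z - c) / r`. The free factor `a` lets the induction pass through complex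
scalars, which do not commute with the real part. -/
theorem exists_entire_re_eq_of_mem_span {c : ℂ} {r : ℝ} (hr : 0 < r) {T : ℝ}
    {g : C(AddCircle T, ℂ)} (hg : g ∈ Submodule.span ℂ (range (@fourier T))) (a : ℂ) :
    ∃ P : ℂ → ℂ, Differentiable ℂ P ∧ ∀ x, (a * g x).re = (P (c + r * fourier 1 x)).re := by
  have hr' : (r : ℂ) ≠ 0 := by exact_mod_cast hr.ne'
  induction hg using Submodule.span_induction generalizing a with
  | mem g hg =>
    obtain ⟨n, rfl⟩ := hg
    obtain ⟨k, rfl | rfl⟩ := n.eq_nat_or_neg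
    · refine ⟨fun z => a * ((z - c) / r) ^ k, by fun_prop, fun x => ?_⟩
      rw [fourier_eq_pow]
      congr 3
      field_simp
      ring
    · refine ⟨fun z => (starRingEnd ℂ) a * ((z - c) / r) ^ k, by fun_prop, fun x => ?_⟩
      rw [fourier_neg, fourier_eq_pow, ← Complex.conj_re, map_mul, Complex.conj_conj]
      congr 3
      field_simp
      ring
  | zero => exact ⟨0, differentiable_const 0, fun x => by simp⟩
  | add g₁ g₂ _ _ h₁ h₂ =>
    obtain ⟨P, hP, hP'⟩ := h₁ a
    obtain ⟨Q, hQ, hQ'⟩ := h₂ a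
    refine ⟨fun z => P z + Q z, hP.add hQ, fun x => ?_⟩
    rw [ContinuousMap.add_apply, mul_add, Complex.add_re, hP', hQ', Complex.add_re]
  | smul b g _ h =>
    obtain ⟨P, hP, hP'⟩ := h (a * b)
    refine ⟨P, hP, fun x => ?_⟩
    rw [← hP', ContinuousMap.smul_apply, smul_eq_mul, mul_assoc]

/-- Real parts of entire functions are dense in the continuous functions on a circle. -/
theorem exists_entire_re_near {φ : ℂ → ℝ} (hφ : Continuous φ) (c : ℂ) {r : ℝ} (hr : 0 < r) {ε : ℝ}
    (hε : 0 < ε) :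
    ∃ P : ℂ → ℂ, Differentiable ℂ P ∧ ∀ z ∈ sphere c r, |φ z - (P z).re| < ε := by
  have : Fact (0 < 2 * π) := ⟨two_pi_pos⟩
  let F : C(AddCircle (2 * π), ℂ) :=
    ⟨fun x => (φ (c + r * fourier 1 x) : ℂ), by fun_prop⟩
  have hF : F ∈ (Submodule.span ℂ (range (@fourier (2 * π)))).topologicalClosure := by
    rw [span_fourier_closure_eq_top]; trivial
  rw [← SetLike.mem_coe, Submodule.topologicalClosure_coe, Metric.mem_closure_iff] at hF
  obtain ⟨g, hg, hgF⟩ := hF ε hε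
  obtain ⟨P, hP, hP'⟩ := exists_entire_re_eq_of_mem_span (c := c) hr hg 1
  refine ⟨P, hP, fun z hz => ?_⟩
  rw [← abs_of_pos hr, ← image_circleMap_Ioc] at hz
  obtain ⟨θ, _, rfl⟩ := hz
  have hz : circleMap c r θ = c + r * fourier 1 (θ : AddCircle (2 * π)) := by
    rw [fourier_coe_apply, circleMap]
    congr 3
    have : (π : ℂ) ≠ 0 := by exact_mod_cast pi_ne_zero
    push_cast
    field_simp
  rw [hz, ← hP', one_mul]
  have h1 : dist (F (θ : AddCircle (2 * π))) (g θ) < ε :=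
    (ContinuousMap.dist_apply_le_dist _).trans_lt hgF
  refine lt_of_le_of_lt ?_ h1
  rw [dist_eq_norm]
  have h2 := Complex.abs_re_le_norm (F (θ : AddCircle (2 * π)) - g θ)
  simpa [F] using h2

/-- `v` is not touched from above at `a` by a strictly superharmonic function of the form harmonic
minus `ε ‖ζ - a‖ ^ 2`. -/
def NoTouch (v : ℂ → EReal) (a : ℂ) : Prop :=
  ∀ m : ℝ, v a = m → ∀ h : ℂ → ℝ, HarmonicAt h a → ∀ ε > 0,
    ¬ ∀ᶠ z in 𝓝 a, v z ≤ ((m + h z - h a - ε * ‖z - a‖ ^ 2 : ℝ) : EReal)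

theorem norm_sub_sq_eq (z a b : ℂ) :
    ‖z - b‖ ^ 2 = ‖z - a‖ ^ 2 + (2 * (starRingEnd ℂ) (a - b) * (z - a)).re + ‖a - b‖ ^ 2 := by
  simp only [← Complex.normSq_eq_norm_sq, Complex.normSq_apply]
  simp
  ring

/-- The squared distances to `a` and to `b` differ by a harmonic function, so the quadratic term may
be centred anywhere. -/
theorem NoTouch.not_eventually_le {v : ℂ → EReal} {a : ℂ} (hv : NoTouch v a) {m : ℝ} (hm : v a = m)
    {h : ℂ → ℝ} (hh : HarmonicAt h a) {ε : ℝ} (hε : 0 < ε) (b : ℂ) :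
    ¬ ∀ᶠ z in 𝓝 a, v z ≤ ((m + h z - h a - ε * (‖z - b‖ ^ 2 - ‖a - b‖ ^ 2) : ℝ) : EReal) := by
  intro hev
  have hlin : HarmonicAt (fun z => (-(ε * (2 * (starRingEnd ℂ) (a - b) * (z - a)))).re) a := by
    apply AnalyticAt.harmonicAt_re
    exact Differentiable.analyticAt (by fun_prop) a
  refine hv m hm _ (hh.add hlin) ε hε ?_
  filter_upwards [hev] with z hz
  refine hz.trans (EReal.coe_le_coe_iff.2 (le_of_eq ?_))
  rw [norm_sub_sq_eq z a b]
  simp only [Pi.add_apply, sub_self, mul_zero, neg_zero, Complex.zero_re, Complex.neg_re,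
    Complex.re_ofReal_mul]
  ring

/-- Comparison principle: maximise `v - h + ε ‖z - c‖ ^ 2`. An interior maximum is excluded by
`NoTouch`, a boundary one by taking `ε r ^ 2` smaller than the supposed excess of `v` over `h` at
`z₀`. -/
theorem le_of_noTouch_of_sphere_le {v : ℂ → EReal} {c : ℂ} {r : ℝ}
    (husc : UpperSemicontinuousOn v (closedBall c r)) (htop : ∀ z ∈ closedBall c r, v z < ⊤)
    (hv : ∀ z ∈ ball c r, NoTouch v z) {h : ℂ → ℝ} (hh : ∀ z, HarmonicAt h z)
    (hle : ∀ z ∈ sphere c r, v z ≤ h z) {z₀ : ℂ} (hz₀ : z₀ ∈ closedBall c r) : v z₀ ≤ h z₀ := by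
  by_contra hlt
  rw [not_le] at hlt
  obtain ⟨x, hx1, hx2⟩ := EReal.lt_iff_exists_real_btwn.1 hlt
  rw [EReal.coe_lt_coe_iff] at hx1
  have hb : v z₀ ≠ ⊥ := (bot_le.trans_lt hx2).ne'
  obtain ⟨ε, hε, hεr⟩ : ∃ ε > 0, ε * r ^ 2 < x - h z₀ := by
    refine ⟨(x - h z₀) / (r ^ 2 + 1), by have := sub_pos.2 hx1; positivity, ?_⟩
    rw [div_mul_eq_mul_div, div_lt_iff₀ (by positivity)]
    nlinarith [sub_pos.2 hx1]
  have hcont : Continuous h := continuous_iff_continuousAt.2 fun z => (hh z).1.continuousAt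
  obtain ⟨y, hy, m, hm, hmax⟩ := exists_max_add (isCompact_closedBall c r) husc htop
    (T := fun z => - h z + ε * ‖z - c‖ ^ 2) (by fun_prop) hz₀ hb
  have h1 := hx2.trans_le (hmax z₀ hz₀)
  rw [EReal.coe_lt_coe_iff] at h1
  have h2 : 0 ≤ ε * ‖z₀ - c‖ ^ 2 := by positivity
  rcases (mem_closedBall.1 hy).lt_or_eq with hlt' | heq
  · refine (hv y hlt').not_eventually_le hm (hh y) hε c ?_
    filter_upwards [isOpen_ball.mem_nhds (mem_ball.2 hlt')] with z hz
    refine (hmax z (ball_subset_closedBall hz)).trans (EReal.coe_le_coe_iff.2 (le_of_eq ?_))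
    ring
  · have h3 := hle y heq
    rw [hm, EReal.coe_le_coe_iff] at h3
    rw [dist_eq_norm] at heq
    rw [heq] at h1
    linarith

theorem le_circleAverage_of_noTouch {v : ℂ → EReal} {c : ℂ} {r : ℝ} (hr : 0 < r)
    (husc : UpperSemicontinuousOn v (closedBall c r)) (htop : ∀ z ∈ closedBall c r, v z < ⊤)
    (hv : ∀ z ∈ ball c r, NoTouch v z) {φ : ℂ → ℝ} (hφ : Continuous φ)
    (hle : ∀ z ∈ sphere c r, v z ≤ φ z) : v c ≤ ((circleAverage φ c r : ℝ) : EReal) := by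
  refine EReal.le_of_forall_lt_iff_le.1 fun t ht => ?_
  rw [EReal.coe_lt_coe_iff] at ht
  set ε := (t - circleAverage φ c r) / 2 with hε
  have hε0 : 0 < ε := by rw [hε]; linarith
  -- Approximating `φ + ε` within `ε` squeezes `Re P` between `φ` and `φ + 2 ε` on the circle; this
  -- replaces solving the Dirichlet problem.
  obtain ⟨P, hP, hPφ⟩ := exists_entire_re_near (φ := fun z => φ z + ε) (by fun_prop) c hr hε0
  have hh : ∀ z, HarmonicAt (fun z => (P z).re) z := fun z => (hP.analyticAt z).harmonicAt_re
  have h1 : v c ≤ ((P c).re : ℝ) := by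
    refine le_of_noTouch_of_sphere_le husc htop hv hh (fun z hz => ?_) (mem_closedBall_self hr.le)
    refine (hle z hz).trans (EReal.coe_le_coe_iff.2 ?_)
    have := (abs_lt.1 (hPφ z hz)).2
    linarith
  refine h1.trans (EReal.coe_le_coe_iff.2 ?_)
  have h2 : circleAverage (fun z => (P z).re) c r = (P c).re :=
    InnerProductSpace.HarmonicOnNhd.circleAverage_eq fun z _ => hh z
  rw [← h2]
  have hφi : CircleIntegrable φ c r := hφ.continuousOn.circleIntegrable hr.le
  have hci : CircleIntegrable (fun _ => 2 * ε) c r := circleIntegrable_const _ _ _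
  have h3 : circleAverage (fun z => (P z).re) c r ≤ circleAverage (fun z => φ z + 2 * ε) c r := by
    apply circleAverage_mono
    · exact (Complex.continuous_re.comp hP.continuous).continuousOn.circleIntegrable hr.le
    · exact hφi.add hci
    · intro z hz
      rw [abs_of_pos hr] at hz
      have := (abs_lt.1 (hPφ z hz)).1
      linarith
  rw [circleAverage_fun_add hφi hci, circleAverage_const] at h3
  linarith

/-- An upper semicontinuous function on a compact metric set is the limit of a decreasing sequence
of continuous functions. -/
theorem exists_antitone_continuous_approx {X : Type*} [MetricSpace X] {v : X → EReal} {S : Set X}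
    (hS : IsCompact S) (husc : UpperSemicontinuousOn v S) (htop : ∀ z ∈ S, v z < ⊤) :
    ∃ φ : ℕ → X → ℝ, (∀ j, Continuous (φ j)) ∧ (∀ x, Antitone fun j => φ j x) ∧
      (∀ j, ∀ x ∈ S, v x ≤ φ j x) ∧
      ∀ x ∈ S, ∀ t : ℝ, v x < t → ∃ j, φ j x ≤ t := by
  rcases S.eq_empty_or_nonempty with rfl | hne
  · exact ⟨fun _ _ => 0, fun _ => continuous_const, fun x => antitone_const, by simp, by simp⟩
  obtain ⟨M₀, hM₀⟩ := exists_real_bound hS husc htop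
  set M := max M₀ 0
  have hM : ∀ z ∈ S, v z ≤ (M : EReal) := fun z hz =>
    (hM₀ z hz).trans (EReal.coe_le_coe_iff.2 (le_max_left _ _))
  have hM0 : 0 ≤ M := le_max_right _ _
  have : Nonempty S := hne.to_subtype
  set b : ℕ → S → ℝ := fun j y => (max (v y) ((-(j : ℝ) : ℝ) : EReal)).toReal with hb
  have hbcoe : ∀ j y, ((b j y : ℝ) : EReal) = max (v y) ((-(j : ℝ) : ℝ) : EReal) := by
    intro j y
    refine EReal.coe_toReal ?_ ?_
    · exact (max_lt (htop y y.2) (EReal.coe_lt_top _)).ne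
    · exact ((EReal.bot_lt_coe _).trans_le (le_max_right _ _)).ne'
  have hbM : ∀ j y, b j y ≤ M := by
    intro j y
    rw [← EReal.coe_le_coe_iff, hbcoe]
    refine max_le (hM y y.2) (EReal.coe_le_coe_iff.2 ?_)
    have : (0 : ℝ) ≤ j := j.cast_nonneg
    linarith
  have hban : ∀ y, Antitone fun j => b j y := by
    intro y j k hjk
    change b k y ≤ b j y
    rw [← EReal.coe_le_coe_iff, hbcoe, hbcoe]
    refine max_le_max le_rfl (EReal.coe_le_coe_iff.2 ?_)
    have : (j : ℝ) ≤ k := by exact_mod_cast hjk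
    linarith
  -- Sup-convolution of `v` truncated below at `-j`: it is `j`-Lipschitz because of the distance
  -- term, and real because of the truncation.
  set φ : ℕ → X → ℝ := fun j x => ⨆ y : S, (b j y - j * dist x y) with hφ
  have hbdd : ∀ (j : ℕ) (x : X), BddAbove (range fun y : S => b j y - j * dist x (y : X)) := by
    rintro j x
    refine ⟨M, ?_⟩
    rintro _ ⟨y, rfl⟩
    have := hbM j y
    have h2 : 0 ≤ (j : ℝ) * dist x (y : X) := by positivity
    dsimp only
    linarith
  refine ⟨φ, fun j => ?_, fun x j k hjk => ?_, fun j x hx => ?_, fun x hx t ht => ?_⟩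
  · have hL : LipschitzWith (j : NNReal) (φ j) := by
      refine LipschitzWith.of_le_add_mul _ fun x x' => ciSup_le fun y => ?_
      have h1 := le_ciSup (hbdd j x') y
      have h2 := dist_triangle x' x y
      rw [dist_comm x' x] at h2
      have h3 : (j : ℝ) * dist x' y ≤ j * (dist x x' + dist x y) := by gcongr
      rw [NNReal.coe_natCast]
      change _ ≤ (⨆ y : S, (b j y - j * dist x' y)) + _
      linarith
    exact hL.continuous
  · refine ciSup_mono (hbdd j x) fun y => ?_
    have h1 : b k y ≤ b j y := hban y hjk
    have : (j : ℝ) ≤ k := by exact_mod_cast hjk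
    have h2 : (j : ℝ) * dist x y ≤ k * dist x y := by gcongr
    linarith
  · have h1 := le_ciSup (hbdd j x) ⟨x, hx⟩
    simp only [dist_self, mul_zero, sub_zero] at h1
    refine le_trans ?_ (EReal.coe_le_coe_iff.2 h1)
    rw [hbcoe]
    exact le_max_left _ _
  · have hev := husc x hx t ht
    rw [Metric.nhdsWithin_basis_ball.eventually_iff] at hev
    obtain ⟨ρ, hρ, hev⟩ := hev
    -- The first bound puts the truncation level below `t` for `y` near `x`; the second makes the
    -- distance penalty beat the upper bound `M` for `y` at distance at least `ρ`.
    obtain ⟨j, hj⟩ := exists_nat_ge (max (-t) ((M - t) / ρ))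
    have hj1 := (le_max_left _ _).trans hj
    have hj2 := (le_max_right _ _).trans hj
    rw [div_le_iff₀ hρ] at hj2
    refine ⟨j, ciSup_le fun y => ?_⟩
    rcases lt_or_ge (dist (y : X) x) ρ with hlt | hge
    · have h1 : b j y ≤ t := by
        rw [← EReal.coe_le_coe_iff, hbcoe]
        refine max_le (hev ⟨hlt, y.2⟩).le (EReal.coe_le_coe_iff.2 (by linarith))
      have h2 : 0 ≤ (j : ℝ) * dist x y := by positivity
      linarith
    · have h1 := hbM j y
      have h2 : (j : ℝ) * ρ ≤ j * dist x y := by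
        rw [dist_comm]
        gcongr
      linarith

/-- Comparison bounds `v c` by the means of continuous functions decreasing to `v`. Monotone
convergence for the differences `φ 0 - φ j` passes to the limit, and finiteness of `v c` makes the
limit integrable. -/
theorem hasSubmean_of_noTouch {v : ℂ → EReal} {c : ℂ} {r : ℝ} (hr : 0 < r)
    (husc : UpperSemicontinuousOn v (closedBall c r)) (htop : ∀ z ∈ closedBall c r, v z < ⊤)
    (hv : ∀ z ∈ ball c r, NoTouch v z) (hc : v c ≠ ⊥) : HasSubmean v c r := by
  obtain ⟨φ, hφc, hφa, hφv, hφt⟩ := exists_antitone_continuous_approx (isCompact_sphere c r)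
    (husc.mono sphere_subset_closedBall) (fun z hz => htop z (sphere_subset_closedBall hz))
  set L := (v c).toReal
  have hL : v c = L := (EReal.coe_toReal (htop c (mem_closedBall_self hr.le)).ne hc).symm
  have hLφ : ∀ j, 2 * π * L ≤ ∫ θ in Ioc 0 (2 * π), φ j (circleMap c r θ) := by
    intro j
    have h1 := le_circleAverage_of_noTouch hr husc htop hv (hφc j) (hφv j)
    rw [hL, EReal.coe_le_coe_iff, circleAverage_eq_setIntegral] at h1
    have h3 := mul_le_mul_of_nonneg_left h1 two_pi_pos.le
    rwa [← mul_assoc _ (2 * π)⁻¹, mul_inv_cancel₀ two_pi_pos.ne', one_mul] at h3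
  have hφi : ∀ j, IntegrableOn (fun θ => φ j (circleMap c r θ)) (Ioc 0 (2 * π)) := fun j =>
    circleIntegrable_iff_integrableOn.1 ((hφc j).continuousOn.circleIntegrable hr.le)
  set F : ℕ → ℂ → ENNReal := fun j z => ENNReal.ofReal (φ 0 z - φ j z) with hF
  have hFmono : ∀ z, Monotone fun j => F j z := fun z j k hjk =>
    ENNReal.ofReal_le_ofReal (by have := hφa z hjk; dsimp only at this; linarith)
  have hFm : ∀ j, Measurable fun θ => F j (circleMap c r θ) := fun j =>
    ENNReal.measurable_ofReal.comp
      (((hφc 0).sub (hφc j)).comp (continuous_circleMap c r)).measurable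
  set C := (∫ θ in Ioc 0 (2 * π), φ 0 (circleMap c r θ)) - 2 * π * L with hC
  have hC0 : 0 ≤ C := by have := hLφ 0; rw [hC]; linarith
  have hint : ∫⁻ θ in Ioc 0 (2 * π), ⨆ j, F j (circleMap c r θ) ≤ ENNReal.ofReal C := by
    rw [lintegral_iSup hFm (fun j k hjk θ => hFmono _ hjk)]
    refine iSup_le fun j => ?_
    have hae : 0 ≤ᵐ[volume.restrict (Ioc 0 (2 * π))]
        fun θ => φ 0 (circleMap c r θ) - φ j (circleMap c r θ) := by
      refine ae_of_all _ fun θ => ?_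
      have := hφa (circleMap c r θ) (Nat.zero_le j)
      simpa using this
    refine (ofReal_integral_eq_lintegral_ofReal ((hφi 0).sub (hφi j)) hae).symm.le.trans ?_
    refine ENNReal.ofReal_le_ofReal ?_
    refine (integral_sub (hφi 0) (hφi j)).le.trans ?_
    rw [hC]
    linarith [hLφ j]
  have hfin := ne_top_of_le_ne_top ENNReal.ofReal_ne_top hint
  have hSm : Measurable fun θ => ⨆ j, F j (circleMap c r θ) := Measurable.iSup hFm
  have hlt := ae_lt_top hSm hfin
  have hSi := integrable_toReal_of_lintegral_ne_top hSm.aemeasurable hfin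
  refine ⟨fun z => φ 0 z - (⨆ j, F j z).toReal, ?_, ?_, ?_⟩
  · rw [circleIntegrable_iff_integrableOn]
    exact (hφi 0).sub hSi
  · filter_upwards [hlt] with θ hθ
    refine EReal.le_of_forall_lt_iff_le.1 fun t ht => ?_
    obtain ⟨j, hj⟩ := hφt _ (circleMap_mem_sphere c hr.le θ) t ht
    have h1 : ENNReal.ofReal (φ 0 (circleMap c r θ) - t) ≤ ⨆ j, F j (circleMap c r θ) :=
      le_trans (ENNReal.ofReal_le_ofReal (by linarith))
        (le_iSup (fun j => F j (circleMap c r θ)) j)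
    rw [ENNReal.ofReal_le_iff_le_toReal hθ.ne] at h1
    rw [EReal.coe_le_coe_iff]
    linarith
  · rw [hL, EReal.coe_le_coe_iff, circleAverage_eq_setIntegral]
    rw [integral_sub (hφi 0) hSi, integral_toReal hSm.aemeasurable hlt]
    have h2 := ENNReal.toReal_le_of_le_ofReal hC0 hint
    rw [le_inv_mul_iff₀ two_pi_pos]
    linarith

end SCV

/-! ### Means of squared norms over small circles -/

namespace SCV
open Filter Topology Metric Real InnerProductSpace

section Averages

variable {E : Type*} [NormedAddCommGroup E] [InnerProductSpace ℂ E]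

theorem circleAverage_re_inner {r : ℝ} (hr : 0 < r) {H : ℂ → E}
    (hH : ∀ z ∈ closedBall (0 : ℂ) r, AnalyticAt ℂ H z) (H0 : H 0 = 0) (d : E) :
    circleAverage (fun τ => 2 * (inner ℂ d (H τ)).re) 0 r = 0 := by
  have h := InnerProductSpace.HarmonicOnNhd.circleAverage_eq (c := 0) (R := r)
    (f := fun τ => ((2 : ℂ) * inner ℂ d (H τ)).re) ?_
  · simpa [H0] using h
  · rw [abs_of_pos hr]
    intro z hz
    apply AnalyticAt.harmonicAt_re
    exact analyticAt_const.mul (((innerSL ℂ d).analyticAt _).comp (hH z hz))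

/-- Expanding the square, the cross term is harmonic and vanishes at the centre, so it has mean
zero. -/
theorem circleAverage_norm_add_sq_le {r : ℝ} (hr : 0 < r) {H : ℂ → E}
    (hH : ∀ z ∈ closedBall (0 : ℂ) r, AnalyticAt ℂ H z) (H0 : H 0 = 0) (d : E) {C : ℝ}
    (hC : ∀ z ∈ sphere (0 : ℂ) r, ‖H z‖ ≤ C) :
    circleAverage (fun τ => ‖d + H τ‖ ^ 2) 0 r ≤ ‖d‖ ^ 2 + C ^ 2 := by
  have hcont : ContinuousOn H (sphere 0 r) := fun z hz =>
    (hH z (sphere_subset_closedBall hz)).continuousAt.continuousWithinAt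
  have hi1 : CircleIntegrable (fun τ => 2 * (inner ℂ d (H τ)).re) 0 r := by
    apply ContinuousOn.circleIntegrable hr.le
    exact continuousOn_const.mul
      (Complex.continuous_re.comp_continuousOn (continuousOn_const.inner hcont))
  have hi2 : CircleIntegrable (fun _ : ℂ => ‖d‖ ^ 2 + C ^ 2) 0 r := circleIntegrable_const _ _ _
  have hi : CircleIntegrable (fun τ => ‖d + H τ‖ ^ 2) 0 r := by
    apply ContinuousOn.circleIntegrable hr.le
    fun_prop
  have key := circleAverage_mono (c := 0) (R := r) hi (hi1.add hi2) (fun z hz => by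
    rw [abs_of_pos hr] at hz
    have h1 := norm_add_sq (𝕜 := ℂ) d (H z)
    have h2 := hC z hz
    have h3 : ‖H z‖ ^ 2 ≤ C ^ 2 := by gcongr
    change _ ≤ 2 * (inner ℂ d (H z)).re + (‖d‖ ^ 2 + C ^ 2)
    rw [h1]
    change _ + 2 * (inner ℂ d (H z)).re + _ ≤ _
    linarith)
  rw [circleAverage_add hi1 hi2, circleAverage_re_inner hr hH H0, circleAverage_const,
    zero_add] at key
  exact key

theorem circleAverage_norm_add_smul_sq {r : ℝ} (hr : 0 < r) (b a : E) :
    circleAverage (fun τ : ℂ => ‖b + τ • a‖ ^ 2) 0 r = ‖b‖ ^ 2 + r ^ 2 * ‖a‖ ^ 2 := by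
  have hH : ∀ z ∈ closedBall (0 : ℂ) r, AnalyticAt ℂ (fun τ : ℂ => τ • a) z := fun z _ =>
    analyticAt_id.smul analyticAt_const
  have hi1 : CircleIntegrable (fun τ : ℂ => 2 * (inner ℂ b (τ • a)).re) 0 r := by
    apply ContinuousOn.circleIntegrable hr.le
    fun_prop
  have hi2 : CircleIntegrable (fun _ : ℂ => ‖b‖ ^ 2 + r ^ 2 * ‖a‖ ^ 2) 0 r :=
    circleIntegrable_const _ _ _
  have h1 : circleAverage (fun τ : ℂ => ‖b + τ • a‖ ^ 2) 0 r =
      circleAverage (fun τ : ℂ => 2 * (inner ℂ b (τ • a)).re + (‖b‖ ^ 2 + r ^ 2 * ‖a‖ ^ 2)) 0 r := by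
    apply circleAverage_congr_sphere
    intro z hz
    rw [abs_of_pos hr, mem_sphere_zero_iff_norm] at hz
    have h1 := norm_add_sq (𝕜 := ℂ) b (z • a)
    dsimp only
    rw [h1, norm_smul, hz]
    change _ + 2 * (inner ℂ b (z • a)).re + _ = _
    ring
  rw [h1, circleAverage_fun_add hi1 hi2, circleAverage_re_inner hr hH (by simp),
    circleAverage_const, zero_add]

theorem HasSubmean.zero (c : ℂ) (r : ℝ) : HasSubmean (fun _ => 0) c r :=
  ⟨fun _ => 0, circleIntegrable_const _ _ _, by simp, by simp [circleAverage_const]⟩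

/-- A function with the sub-mean property cannot be touched from above by a strictly superharmonic
function perturbed by a term whose mean vanishes to higher order. -/
theorem not_eventually_le_of_hasSubmean {F : Type*} [NormedAddCommGroup F] [InnerProductSpace ℂ F]
    [CompleteSpace F]
    {s : ℂ → EReal} (hs : ∀ᶠ r in 𝓝[>] (0 : ℝ), HasSubmean s 0 r) {m : ℝ} (hm : s 0 = m)
    {q : ℂ → ℝ} (hq : HarmonicAt q 0) {H : ℂ → F} (hH : AnalyticAt ℂ H 0) (H0 : H 0 = 0)
    (H1 : HasDerivAt H 0 0) (d : F) {ε k : ℝ} (hε : 0 < ε) (hk : 0 ≤ k) (b : E) {a : E}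
    (ha : a ≠ 0) :
    ¬ ∀ᶠ τ in 𝓝 (0 : ℂ), s τ ≤ ((m + (q τ - q 0) - ε * (‖b + τ • a‖ ^ 2 - ‖b‖ ^ 2) +
      k * (‖d + H τ‖ ^ 2 - ‖d‖ ^ 2) : ℝ) : EReal) := by
  intro hev
  have ha' : 0 < ‖a‖ := norm_pos_iff.2 ha
  -- On a circle of radius `r` the quadratic term lowers the mean by `ε ‖a‖ ^ 2 r ^ 2`, while `‖H τ‖
  -- ≤ κ ‖τ‖` lets the penalty raise it by at most `k κ ^ 2 r ^ 2`.
  obtain ⟨κ, hκ, hκk⟩ : ∃ κ > 0, k * κ ^ 2 < ε * ‖a‖ ^ 2 := by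
    have h0 : 0 < ε * ‖a‖ ^ 2 := by positivity
    refine ⟨√(ε * ‖a‖ ^ 2 / (k + 1)), by positivity, ?_⟩
    rw [sq_sqrt (by positivity), mul_div_assoc', div_lt_iff₀ (by positivity)]
    nlinarith
  have hlit : ∀ᶠ τ in 𝓝 (0 : ℂ), ‖H τ‖ ≤ κ * ‖τ‖ := by
    have := (hasDerivAt_iff_isLittleO_nhds_zero.1 H1).bound hκ
    simpa [H0] using this
  have hall := ((hev.and hlit).and (hq.eventually.and hH.eventually_analyticAt))
  rw [Metric.nhds_basis_closedBall.eventually_iff] at hall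
  obtain ⟨ρ, hρ, hall⟩ := hall
  obtain ⟨r, ⟨hrs, hrρ⟩, hr⟩ := ((hs.and (Ioo_mem_nhdsGT hρ)).and self_mem_nhdsWithin).exists
  have hsub : closedBall (0 : ℂ) r ⊆ closedBall 0 ρ := closedBall_subset_closedBall hrρ.2.le
  have hqc : ContinuousOn q (sphere 0 r) := fun z hz =>
    (hall (hsub (sphere_subset_closedBall hz))).2.1.1.continuousAt.continuousWithinAt
  have hHc : ContinuousOn H (sphere 0 r) := fun z hz =>
    (hall (hsub (sphere_subset_closedBall hz))).2.2.continuousAt.continuousWithinAt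
  have hi1 : CircleIntegrable q 0 r := hqc.circleIntegrable hr.le
  have hi2 : CircleIntegrable (fun τ : ℂ => (-ε) • ‖b + τ • a‖ ^ 2) 0 r :=
    ContinuousOn.circleIntegrable hr.le (by fun_prop)
  have hi3 : CircleIntegrable (fun τ : ℂ => k • ‖d + H τ‖ ^ 2) 0 r :=
    ContinuousOn.circleIntegrable hr.le (by fun_prop)
  have hi4 : CircleIntegrable (fun _ : ℂ => m - q 0 + ε * ‖b‖ ^ 2 - k * ‖d‖ ^ 2) 0 r :=
    circleIntegrable_const _ _ _
  have key := hrs.le_circleAverage hr.le (((hi1.add hi2).add hi3).add hi4) (fun z hz => by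
    refine (hall (hsub (sphere_subset_closedBall hz))).1.1.trans
      (EReal.coe_le_coe_iff.2 (le_of_eq ?_))
    simp only [Pi.add_apply, smul_eq_mul]
    ring)
  rw [hm, EReal.coe_le_coe_iff, circleAverage_add ((hi1.add hi2).add hi3) hi4,
    circleAverage_add (hi1.add hi2) hi3, circleAverage_add hi1 hi2, circleAverage_const,
    circleAverage_fun_smul, circleAverage_fun_smul, circleAverage_norm_add_smul_sq hr] at key
  have h1 : circleAverage q 0 r = q 0 :=
    InnerProductSpace.HarmonicOnNhd.circleAverage_eq fun z hz => by
      rw [abs_of_pos hr] at hz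
      exact (hall (hsub hz)).2.1
  have h2 := circleAverage_norm_add_sq_le hr (fun z hz => (hall (hsub hz)).2.2) H0 d
    (C := κ * r) (fun z hz => by
      have := (hall (hsub (sphere_subset_closedBall hz))).1.2
      rwa [mem_sphere_zero_iff_norm.1 hz] at this)
  have h3 := mul_le_mul_of_nonneg_left h2 hk
  simp only [smul_eq_mul] at key
  rw [h1] at key
  have h4 : r ^ 2 * (k * κ ^ 2) < r ^ 2 * (ε * ‖a‖ ^ 2) := by gcongr
  nlinarith

end Averages

/-! ### Regularity of derivatives by one-variable methods -/

section Derivatives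

variable {E F : Type*} [NormedAddCommGroup E] [NormedSpace ℂ E] [NormedAddCommGroup F]
  [NormedSpace ℂ F] {f : E → F} {D : Set E}

theorem DifferentiableAt.hasDerivAt_line {z a : E} {τ : ℂ} (h : DifferentiableAt ℂ f (z + τ • a)) :
    HasDerivAt (fun ξ : ℂ => f (z + ξ • a)) (fderiv ℂ f (z + τ • a) a) τ := by
  have h1 : HasDerivAt (fun ξ : ℂ => z + ξ • a) a τ := by
    simpa using ((hasDerivAt_id τ).smul_const a).const_add z
  exact h.hasFDerivAt.comp_hasDerivAt τ h1

/-- Cauchy's estimate on a disc in direction `a`, applied to the difference of the slices of `f`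
through `z'` and `z`, which is uniformly small on the compact disc. -/
theorem continuousOn_fderiv_apply (hD : IsOpen D) (hf : DifferentiableOn ℂ f D) (a : E) :
    ContinuousOn (fun z => fderiv ℂ f z a) D := by
  intro z hz
  refine ContinuousAt.continuousWithinAt ?_
  have hline : ContinuousAt (fun p : E × ℂ => p.1 + p.2 • a) (z, 0) := by fun_prop
  have hev : ∀ᶠ p : E × ℂ in 𝓝 (z, 0), p.1 + p.2 • a ∈ D :=
    hline.eventually_mem (hD.mem_nhds (by simpa using hz))
  rw [nhds_prod_eq, eventually_prod_iff] at hev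
  obtain ⟨pa, hpa, pb, hpb, hab⟩ := hev
  rw [Metric.nhds_basis_closedBall.eventually_iff] at hpb
  obtain ⟨ρ, hρ, hpb⟩ := hpb
  rw [Metric.continuousAt_iff']
  intro η hη
  have hunif : ∀ᶠ z' in 𝓝 z, ∀ ξ ∈ closedBall (0 : ℂ) ρ,
      ‖f (z' + ξ • a) - f (z + ξ • a)‖ < η * ρ / 2 := by
    refine (isCompact_closedBall (0 : ℂ) ρ).eventually_forall_of_forall_eventually fun ξ hξ => ?_
    have hc : ContinuousAt f (z + ξ • a) :=
      (hf.differentiableAt (hD.mem_nhds (hab hpa.self_of_nhds (hpb hξ)))).continuousAt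
    have h1 : ContinuousAt (fun p : E × ℂ => f (p.1 + p.2 • a)) (z, ξ) :=
      ContinuousAt.comp (g := f) (f := fun p : E × ℂ => p.1 + p.2 • a) hc (by fun_prop)
    have h2 : ContinuousAt (fun p : E × ℂ => f (z + p.2 • a)) (z, ξ) :=
      ContinuousAt.comp (g := f) (f := fun p : E × ℂ => z + p.2 • a) hc (by fun_prop)
    have h3 : ContinuousAt (fun p : E × ℂ => ‖f (p.1 + p.2 • a) - f (z + p.2 • a)‖) (z, ξ) :=
      (h1.sub h2).norm
    exact h3.eventually_lt continuousAt_const (by simp; positivity)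
  filter_upwards [hunif, hpa] with z' h1 h2
  have hd : ∀ w, pa w → ∀ ξ ∈ closedBall (0 : ℂ) ρ, HasDerivAt (fun ξ : ℂ => f (w + ξ • a))
      (fderiv ℂ f (w + ξ • a) a) ξ := fun w hw ξ hξ =>
    DifferentiableAt.hasDerivAt_line (hf.differentiableAt (hD.mem_nhds (hab hw (hpb hξ))))
  have h0 := mem_closedBall_self (x := (0 : ℂ)) hρ.le
  have hdz' := hd z' h2 0 h0
  have hdz := hd z hpa.self_of_nhds 0 h0
  have hder := (hdz'.sub hdz).deriv
  have hbound := Complex.norm_deriv_le_of_forall_mem_sphere_norm_le hρ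
    (f := (fun ξ : ℂ => f (z' + ξ • a)) - fun ξ : ℂ => f (z + ξ • a)) (c := 0) (C := η * ρ / 2) ?_ ?_
  · rw [hder] at hbound
    simp only [zero_smul, add_zero] at hbound
    rw [dist_eq_norm]
    refine hbound.trans_lt ?_
    rw [div_lt_iff₀ hρ]
    nlinarith [mul_pos hη hρ]
  · refine DifferentiableOn.diffContOnCl_ball (U := closedBall 0 ρ) (fun ξ hξ => ?_) le_rfl
    exact ((hd z' h2 ξ hξ).sub
      (hd z hpa.self_of_nhds ξ hξ)).differentiableAt.differentiableWithinAt
  · intro ξ hξ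
    exact (h1 ξ (sphere_subset_closedBall hξ)).le

/-- Along the line, the directional derivative is a locally uniform limit of holomorphic difference
quotients; the uniformity comes from continuity of the derivative and the mean value inequality. -/
theorem differentiableOn_fderiv_line [CompleteSpace F] (hD : IsOpen D)
    (hf : DifferentiableOn ℂ f D) (z a e : E) :
    DifferentiableOn ℂ (fun τ : ℂ => fderiv ℂ f (z + τ • a) e) {τ | z + τ • a ∈ D} := by
  have hU : IsOpen {τ : ℂ | z + τ • a ∈ D} := hD.preimage (by fun_prop)
  intro τ₀ hτ₀
  have hcont := continuousOn_fderiv_apply hD hf e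
  have hline : ∀ τ : ℂ, ContinuousAt (fun p : ℂ × ℂ => z + p.1 • a + p.2 • e) (τ, 0) := by
    intro τ; fun_prop
  have hev : ∀ᶠ p : ℂ × ℂ in 𝓝 (τ₀, 0), z + p.1 • a + p.2 • e ∈ D :=
    (hline τ₀).eventually_mem (hD.mem_nhds (by simpa using hτ₀))
  rw [Metric.nhds_basis_ball.eventually_iff] at hev
  obtain ⟨ρ, hρ, hev⟩ := hev
  have hmem : ∀ τ ∈ ball τ₀ ρ, ∀ h ∈ ball (0 : ℂ) ρ, z + τ • a + h • e ∈ D := by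
    intro τ hτ h hh
    exact hev (x := (τ, h)) (by rw [← ball_prod_same]; exact ⟨hτ, hh⟩)
  set t : ℕ → ℂ := fun m => ((1 / ((m : ℝ) + 1) : ℝ) : ℂ) with ht
  have htlim : Tendsto t atTop (𝓝 0) := by
    have := tendsto_one_div_add_atTop_nhds_zero_nat (𝕜 := ℝ)
    exact (Complex.continuous_ofReal.tendsto' 0 0 Complex.ofReal_zero).comp this
  have ht0 : ∀ m, t m ≠ 0 := fun m => by
    have : (1 / ((m : ℝ) + 1)) ≠ 0 := by positivity
    exact Complex.ofReal_ne_zero.2 this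
  have hlim : TendstoLocallyUniformlyOn
      (fun (m : ℕ) (τ : ℂ) => (t m)⁻¹ • (f (z + τ • a + t m • e) - f (z + τ • a)))
      (fun τ => fderiv ℂ f (z + τ • a) e) atTop (ball τ₀ ρ) := by
    rw [Metric.tendstoLocallyUniformlyOn_iff]
    intro η hη τ₁ hτ₁
    have hc : ContinuousAt (fun p : ℂ × ℂ => fderiv ℂ f (z + p.1 • a + p.2 • e) e) (τ₁, 0) := by
      refine ContinuousAt.comp (g := fun w => fderiv ℂ f w e)
        (f := fun p : ℂ × ℂ => z + p.1 • a + p.2 • e) ?_ (hline τ₁)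
      exact hcont.continuousAt (hD.mem_nhds (hmem τ₁ hτ₁ 0 (mem_ball_self hρ)))
    have hc' := Metric.continuousAt_iff.1 hc (η / 3) (by positivity)
    obtain ⟨δ, hδ, hc'⟩ := hc'
    simp only [zero_smul, add_zero] at hc'
    set σ := min δ (ρ - dist τ₁ τ₀) with hσ
    have hσ0 : 0 < σ := lt_min hδ (sub_pos.2 hτ₁)
    refine ⟨ball τ₁ σ, mem_nhdsWithin_of_mem_nhds (ball_mem_nhds _ hσ0), ?_⟩
    have hsmall : ∀ᶠ m in atTop, t m ∈ ball (0 : ℂ) (min δ ρ) :=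
      htlim.eventually_mem (ball_mem_nhds _ (lt_min hδ hρ))
    filter_upwards [hsmall] with m hm τ hτ
    have hτρ : τ ∈ ball τ₀ ρ := by
      have h1 := dist_triangle τ τ₁ τ₀
      have h2 := (mem_ball.1 hτ).trans_le (min_le_right _ _)
      rw [mem_ball]; linarith
    have hclose : ∀ h ∈ ball (0 : ℂ) (min δ ρ),
        ‖fderiv ℂ f (z + τ • a + h • e) e - fderiv ℂ f (z + τ₁ • a) e‖ ≤ η / 3 := by
      intro h hh
      rw [← dist_eq_norm]
      refine (hc' (x := (τ, h)) ?_).le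
      rw [Prod.dist_eq]
      exact max_lt ((mem_ball.1 hτ).trans_le (min_le_left _ _))
        ((mem_ball.1 hh).trans_le (min_le_left _ _))
    set c := fderiv ℂ f (z + τ₁ • a) e
    have hmv := (convex_ball (0 : ℂ) (min δ ρ)).norm_image_sub_le_of_norm_hasDerivWithin_le
      (f := fun h : ℂ => f (z + τ • a + h • e) - h • c)
      (f' := fun h => fderiv ℂ f (z + τ • a + h • e) e - c) (C := η / 3) (x := 0) (y := t m)
      (fun h hh => by
        have h1 := DifferentiableAt.hasDerivAt_line (f := f) (z := z + τ • a) (a := e) (τ := h)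
          (hf.differentiableAt (hD.mem_nhds
            (hmem τ hτρ h (ball_subset_ball (min_le_right _ _) hh))))
        have h2 : HasDerivAt (fun h : ℂ => h • c) c h := by
          simpa using (hasDerivAt_id h).smul_const c
        exact (h1.sub h2).hasDerivWithinAt)
      (fun h hh => hclose h hh) (mem_ball_self (lt_min hδ hρ)) hm
    have htm : ‖t m‖ ≠ 0 := norm_ne_zero_iff.2 (ht0 m)
    have h5 : ‖(t m)⁻¹ • (f (z + τ • a + t m • e) - f (z + τ • a)) - c‖ ≤ η / 3 := by
      have h6 : (t m)⁻¹ • (f (z + τ • a + t m • e) - f (z + τ • a)) - c =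
          (t m)⁻¹ • (f (z + τ • a + t m • e) - t m • c - (f (z + τ • a + (0 : ℂ) • e) -
            (0 : ℂ) • c)) := by
        simp only [zero_smul, add_zero, sub_zero]
        rw [sub_right_comm, smul_sub _ _ (t m • c), smul_smul, inv_mul_cancel₀ (ht0 m), one_smul]
      rw [h6, norm_smul, norm_inv]
      rw [sub_zero] at hmv
      calc ‖t m‖⁻¹ * _ ≤ ‖t m‖⁻¹ * (η / 3 * ‖t m‖) := by gcongr
        _ = η / 3 := by field_simp
    have h7 := hclose 0 (mem_ball_self (lt_min hδ hρ))
    simp only [zero_smul, add_zero] at h7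
    rw [dist_eq_norm]
    calc ‖fderiv ℂ f (z + τ • a) e - (t m)⁻¹ • (f (z + τ • a + t m • e) - f (z + τ • a))‖
        = ‖(fderiv ℂ f (z + τ • a) e - c) -
          ((t m)⁻¹ • (f (z + τ • a + t m • e) - f (z + τ • a)) - c)‖ := by congr 1; abel
      _ ≤ _ := norm_sub_le _ _
      _ < η := by linarith
  have hdiff := hlim.differentiableOn ?_ isOpen_ball
  · exact (hdiff.differentiableAt (ball_mem_nhds _ hρ)).differentiableWithinAt
  · have hsmall : ∀ᶠ m in atTop, t m ∈ ball (0 : ℂ) ρ := htlim.eventually_mem (ball_mem_nhds _ hρ)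
    filter_upwards [hsmall] with m hm τ hτ
    have h1 := DifferentiableAt.hasDerivAt_line (f := f) (z := z) (a := a) (τ := τ)
      (hf.differentiableAt (hD.mem_nhds (by simpa using hmem τ hτ 0 (mem_ball_self hρ))))
    have h2 := DifferentiableAt.hasDerivAt_line (f := f) (z := z + t m • e) (a := a) (τ := τ)
      (hf.differentiableAt (hD.mem_nhds (by
        have := hmem τ hτ _ hm
        rwa [add_right_comm] at this)))
    have h3 := ((h2.sub h1).const_smul (t m)⁻¹).differentiableAt
    refine (h3.congr_of_eventuallyEq (Eventually.of_forall fun τ' => ?_)).differentiableWithinAt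
    simp only [Pi.smul_apply, Pi.sub_apply]
    rw [add_right_comm]

end Derivatives
end SCV

/-! ### The Jacobian determinant and its zeros -/

namespace SCV
open Filter Topology Metric Real InnerProductSpace

section Jacobian

variable {E : Type*} [NormedAddCommGroup E] [NormedSpace ℂ E] {f : E → E} {D : Set E}

/-- The complex Jacobian determinant. -/
noncomputable def jac (f : E → E) (z : E) : ℂ := LinearMap.det (fderiv ℂ f z : E →ₗ[ℂ] E)

variable [FiniteDimensional ℂ E]

theorem jac_eq_sum (f : E → E) (z : E) :
    jac f z = ∑ σ : Equiv.Perm (Fin (Module.finrank ℂ E)), Equiv.Perm.sign σ •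
      ∏ i, LinearMap.toContinuousLinearMap ((Module.finBasis ℂ E).coord (σ i))
        (fderiv ℂ f z (Module.finBasis ℂ E i)) := by
  rw [jac, ← LinearMap.det_toMatrix (Module.finBasis ℂ E), Matrix.det_apply]
  simp [LinearMap.toMatrix_apply]

theorem continuousOn_jac (hD : IsOpen D) (hf : DifferentiableOn ℂ f D) :
    ContinuousOn (jac f) D := by
  have h : ∀ e, ContinuousOn (fun z => fderiv ℂ f z e) D := continuousOn_fderiv_apply hD hf
  refine ContinuousOn.congr ?_ fun z _ => jac_eq_sum f z
  refine continuousOn_finsetSum _ fun σ _ => ContinuousOn.const_smul ?_ _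
  exact continuousOn_finsetProd _ fun i _ =>
    (ContinuousLinearMap.continuous _).comp_continuousOn (h _)

theorem differentiableOn_jac_line [CompleteSpace E] (hD : IsOpen D) (hf : DifferentiableOn ℂ f D)
    (z a : E) : DifferentiableOn ℂ (fun τ : ℂ => jac f (z + τ • a)) {τ | z + τ • a ∈ D} := by
  have h := differentiableOn_fderiv_line hD hf z a
  refine DifferentiableOn.congr ?_ fun τ _ => jac_eq_sum f (z + τ • a)
  refine DifferentiableOn.fun_sum fun σ _ => ?_
  simp only [Units.smul_def, zsmul_eq_mul]
  refine DifferentiableOn.const_mul ?_ _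
  refine DifferentiableOn.fun_finsetProd fun i _ => ?_
  exact (ContinuousLinearMap.differentiable _).comp_differentiableOn (h _)

theorem analyticAt_jac_line [CompleteSpace E] (hD : IsOpen D) (hf : DifferentiableOn ℂ f D)
    {z a : E} {τ : ℂ} (h : z + τ • a ∈ D) :
    AnalyticAt ℂ (fun τ : ℂ => jac f (z + τ • a)) τ :=
  (differentiableOn_jac_line hD hf z a).analyticAt
    ((hD.preimage (by fun_prop : Continuous fun τ : ℂ => z + τ • a)).mem_nhds h)

theorem exists_fderiv_eq_of_jac_ne_zero {z : E} (h : jac f z ≠ 0) (y : E) :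
    ∃ a, fderiv ℂ f z a = y := by
  have h1 : IsUnit (fderiv ℂ f z : E →ₗ[ℂ] E) :=
    (LinearMap.isUnit_iff_isUnit_det _).2 (isUnit_iff_ne_zero.2 h)
  exact (LinearMap.isUnit_iff_range_eq_top _).1 h1 |> LinearMap.range_eq_top.1 |> (· y)

theorem exists_ne_zero_fderiv_eq_zero {z : E} (h : jac f z = 0) :
    ∃ a ≠ 0, fderiv ℂ f z a = 0 := by
  obtain ⟨a, ha, ha0⟩ := (Submodule.ne_bot_iff _).1 (LinearMap.bot_lt_ker_of_det_eq_zero h).ne'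
  exact ⟨a, ha0, ha⟩

/-- One-variable identity theorem on the complex line through `z` and `w`, whose intersection with
the ball is convex. -/
theorem jac_eq_zero_on_ball [CompleteSpace E] (hD : IsOpen D) (hf : DifferentiableOn ℂ f D)
    {x z w : E} {R : ℝ} (hR : ball x R ⊆ D) (hz : z ∈ ball x R)
    (h0 : ∀ᶠ τ in 𝓝 (0 : ℂ), jac f (z + τ • (w - z)) = 0) (hw : w ∈ ball x R) :
    jac f w = 0 := by
  set A := {τ : ℂ | z + τ • (w - z) ∈ ball x R}
  have hconv : Convex ℝ A := by
    have h := (convex_ball x R).affine_preimage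
      ((AffineMap.const ℝ ℂ z : ℂ →ᵃ[ℝ] E) +
        ((LinearMap.toSpanSingleton ℂ E (w - z)).restrictScalars ℝ).toAffineMap)
    simpa [A, preimage] using h
  have han : AnalyticOnNhd ℂ (fun τ : ℂ => jac f (z + τ • (w - z))) A := fun τ hτ =>
    analyticAt_jac_line hD hf (hR hτ)
  have h1 := han.eqOn_zero_of_preconnected_of_eventuallyEq_zero hconv.isPreconnected
    (z₀ := 0) (by simpa [A] using hz) h0
  have h2 : (1 : ℂ) ∈ A := by simpa [A] using hw
  simpa using h1 h2

theorem not_eventually_jac_eq_zero [CompleteSpace E] (hD : IsOpen D) (hc : IsPreconnected D)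
    (hf : DifferentiableOn ℂ f D) {z₁ : E} (hz₁ : z₁ ∈ D) (hJ : jac f z₁ ≠ 0) {z : E} (hz : z ∈ D) :
    ¬ ∀ᶠ w in 𝓝 z, jac f w = 0 := by
  intro hev
  have hsub : D ⊆ interior {w | jac f w = 0} := by
    refine hc.subset_of_closure_inter_subset isOpen_interior
      ⟨z, hz, mem_interior_iff_mem_nhds.2 hev⟩ ?_
    rintro x ⟨hx, hxD⟩
    obtain ⟨R, hR, hRD⟩ := Metric.isOpen_iff.1 hD x hxD
    obtain ⟨s, hs, hsR⟩ := Metric.mem_closure_iff.1 hx R hR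
    rw [dist_comm] at hsR
    refine mem_interior_iff_mem_nhds.2 (mem_of_superset (ball_mem_nhds x hR) fun w hw => ?_)
    refine jac_eq_zero_on_ball hD hf hRD (mem_ball.2 hsR) ?_ hw
    have hc : Tendsto (fun τ : ℂ => s + τ • (w - s)) (𝓝 0) (𝓝 s) :=
      Continuous.tendsto' (by fun_prop) _ _ (by simp)
    exact hc.eventually (mem_interior_iff_mem_nhds.1 hs)
  have h1 : z₁ ∈ {w | jac f w = 0} := interior_subset (hsub hz₁)
  exact hJ h1

end Jacobian

/-! ### Proper maps and suprema over fibres -/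

/-- A holomorphic map on the open set `D` into `G` for which preimages of compact sets are
compact. -/
structure ProperOn {n : ℕ} (f : Cn n → Cn n) (D G : Set (Cn n)) : Prop where
  isOpen : IsOpen D
  differentiableOn : DifferentiableOn ℂ f D
  mapsTo : MapsTo f D G
  isCompact_preimage : ∀ K ⊆ G, IsCompact K → IsCompact (D ∩ f ⁻¹' K)

variable {n : ℕ} {f : Cn n → Cn n} {D G : Set (Cn n)} {u : Cn n → EReal}

theorem IsProperHolomorphic.properOn (h : IsProperHolomorphic f D G) (hD : IsOpen D) :
    ProperOn f D G := by
  obtain ⟨hd, hm, hp⟩ := h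
  refine ⟨hD, hd, hm, fun K hKG hK => ?_⟩
  have h1 : IsCompact ((↑) ⁻¹' K : Set G) := by
    rw [Subtype.isCompact_iff, Subtype.image_preimage_coe, inter_eq_right.2 hKG]
    exact hK
  have h2 := (hp.isCompact_preimage h1).image continuous_subtype_val
  convert! h2 using 1
  ext z
  constructor
  · rintro ⟨h1, h2⟩
    exact ⟨⟨z, h1⟩, h2, rfl⟩
  · rintro ⟨⟨z, h1⟩, h2, rfl⟩
    exact ⟨h1, h2⟩

theorem ProperOn.id (hD : IsOpen D) : ProperOn (fun z : Cn n => z) D D := by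
  refine ⟨hD, differentiableOn_id, mapsTo_id D, fun K hK hKc => ?_⟩
  convert hKc using 1
  exact inter_eq_right.2 hK

/-- If `jac f` vanished identically, `‖z‖ ^ 2 - k ‖f z - f z₀‖ ^ 2` would have an interior maximum.
In a kernel direction of the derivative `f` is constant to first order, so the strictly subharmonic
`‖z‖ ^ 2` contradicts the maximum. -/
theorem ProperOn.exists_jac_ne_zero (hf : ProperOn f D G) (hG : IsOpen G) (hne : D.Nonempty) :
    ∃ z ∈ D, jac f z ≠ 0 := by
  by_contra! hJ
  obtain ⟨z₀, hz₀⟩ := hne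
  obtain ⟨R, hR, hRG⟩ := Metric.nhds_basis_closedBall.mem_iff.1 (hG.mem_nhds (hf.mapsTo hz₀))
  set L := D ∩ f ⁻¹' closedBall (f z₀) R with hL
  have hLc : IsCompact L := hf.isCompact_preimage _ hRG (isCompact_closedBall _ _)
  have hfc := hf.differentiableOn.continuousOn
  have hz₀L : z₀ ∈ L := ⟨hz₀, (mem_closedBall_self hR.le : f z₀ ∈ closedBall (f z₀) R)⟩
  obtain ⟨B, hB⟩ := hLc.exists_bound_of_continuousOn (f := fun z : Cn n => ‖z‖ ^ 2) (by fun_prop)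
  have hB0 : 0 ≤ B := (norm_nonneg _).trans (hB z₀ hz₀L)
  -- With this `k` the function to be maximised is negative where `‖f z - f z₀‖ = R` but nonnegative
  -- at `z₀`, so the maximum is interior.
  obtain ⟨k, hk0, hk⟩ : ∃ k ≥ 0, B < k * R ^ 2 := by
    refine ⟨(B + 1) / R ^ 2, by positivity, ?_⟩
    rw [div_mul_cancel₀ _ (by positivity)]
    linarith
  obtain ⟨z₁, hz₁, hmax⟩ := hLc.exists_isMaxOn ⟨z₀, hz₀L⟩
    (f := fun z => ‖z‖ ^ 2 - k * ‖f z - f z₀‖ ^ 2)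
    (by
      have : ContinuousOn f L := hfc.mono inter_subset_left
      fun_prop)
  have hlt : dist (f z₁) (f z₀) < R := by
    refine lt_of_le_of_ne hz₁.2 fun heq => ?_
    have h1 := hmax hz₀L
    have h2 := hB z₁ hz₁
    rw [dist_eq_norm] at heq
    simp only [mem_ofPred_eq, sub_self, norm_zero, heq] at h1
    rw [norm_of_nonneg (by positivity)] at h2
    have h3 : 0 ≤ ‖z₀‖ ^ 2 := by positivity
    linarith
  have hLn : L ∈ 𝓝 z₁ := by
    have hz₁D := hf.isOpen.mem_nhds hz₁.1
    refine inter_mem hz₁D ?_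
    exact mem_of_superset ((hfc.continuousAt hz₁D) (isOpen_ball.mem_nhds hlt))
      (preimage_mono ball_subset_closedBall)
  obtain ⟨a, ha, hfa⟩ := exists_ne_zero_fderiv_eq_zero (hJ z₁ hz₁.1)
  have hder := DifferentiableAt.hasDerivAt_line (f := f) (z := z₁) (a := a) (τ := 0)
    (hf.differentiableOn.differentiableAt (hf.isOpen.mem_nhds (by simpa using hz₁.1)))
  simp only [zero_smul, add_zero, hfa] at hder
  have hline : Continuous fun τ : ℂ => z₁ + τ • a := by fun_prop
  have han : AnalyticAt ℂ (fun τ : ℂ => f (z₁ + τ • a) - f z₁) 0 := by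
    refine AnalyticAt.sub ?_ analyticAt_const
    refine DifferentiableOn.analyticAt (s := {τ : ℂ | z₁ + τ • a ∈ D}) ?_
      ((hf.isOpen.preimage hline).mem_nhds (by simpa using hz₁.1))
    exact hf.differentiableOn.comp (by fun_prop) fun τ hτ => hτ
  refine not_eventually_le_of_hasSubmean (s := fun _ => 0) (m := 0)
    (Eventually.of_forall fun r => HasSubmean.zero 0 r) (by simp) (q := fun _ => 0)
    (harmonicAt_const 0) han (by simp) (by simpa using hder.sub_const (f z₁)) (f z₁ - f z₀)
    one_pos hk0 z₁ ha ?_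
  have hev : ∀ᶠ τ in 𝓝 (0 : ℂ), z₁ + τ • a ∈ L :=
    hline.continuousAt.eventually_mem (by simpa using hLn)
  filter_upwards [hev] with τ hτ
  have h1 : ‖z₁ + τ • a‖ ^ 2 - k * ‖f (z₁ + τ • a) - f z₀‖ ^ 2 ≤
    ‖z₁‖ ^ 2 - k * ‖f z₁ - f z₀‖ ^ 2 := hmax hτ
  rw [← EReal.coe_zero, EReal.coe_le_coe_iff]
  have h2 : f z₁ - f z₀ + (f (z₁ + τ • a) - f z₁) = f (z₁ + τ • a) - f z₀ := by abel
  rw [h2]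
  linarith

theorem PSHOn.eventually_hasSubmean (hu : PSHOn u D) (hD : IsOpen D) {z : Cn n} (hz : z ∈ D)
    (hb : u z ≠ ⊥) (a : Cn n) :
    ∀ᶠ r in 𝓝[>] (0 : ℝ), HasSubmean (fun τ : ℂ => u (z + τ • a)) 0 r := by
  have hO : IsOpen {τ : ℂ | z + τ • a ∈ D} := hD.preimage (by fun_prop)
  obtain ⟨ρ, hρ, hρD⟩ := Metric.isOpen_iff.1 hO 0 (by simpa using hz)
  filter_upwards [Ioo_mem_nhdsGT hρ] with r hr
  exact (hu.2.2 z a).hasSubmean hr.1 ((closedBall_subset_ball hr.2).trans hρD) (by simpa using hb)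

/-- On a suitable complex line through `z` the zeros of the Jacobian do not accumulate at `z`, so
small circles avoid them; if `u ≤ t` on such circles, then `u z ≤ t`. -/
theorem PSHOn.exists_jac_ne_zero_near (hu : PSHOn u D) (hD : IsOpen D)
    (hf : DifferentiableOn ℂ f D) (hJ : ∀ z ∈ D, ¬ ∀ᶠ w in 𝓝 z, jac f w = 0) {z : Cn n}
    (hz : z ∈ D) {m t : ℝ} (hm : u z = m) (ht : t < m) {N : Set (Cn n)} (hN : N ∈ 𝓝 z) :
    ∃ w ∈ N, w ∈ D ∧ jac f w ≠ 0 ∧ (t : EReal) < u w := by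
  obtain ⟨R, hR, hRN⟩ := Metric.mem_nhds_iff.1 (inter_mem hN (hD.mem_nhds hz))
  obtain ⟨w, hw, hwR⟩ := ((not_eventually.1 (hJ z hz)).and_eventually (ball_mem_nhds z hR)).exists
  have hz0 : ¬ ∀ᶠ τ in 𝓝 (0 : ℂ), jac f (z + τ • (w - z)) = 0 := fun h =>
    hw (jac_eq_zero_on_ball hD hf (fun x hx => (hRN hx).2) (mem_ball_self hR) h hwR)
  have han : AnalyticAt ℂ (fun τ : ℂ => jac f (z + τ • (w - z))) 0 :=
    analyticAt_jac_line hD hf (by simpa using hz)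
  have hne := han.eventually_eq_zero_or_eventually_ne_zero.resolve_left hz0
  have hball : ∀ᶠ τ in 𝓝[≠] (0 : ℂ), z + τ • (w - z) ∈ ball z R := by
    refine nhdsWithin_le_nhds ?_
    refine (Continuous.tendsto' (by fun_prop) (0 : ℂ) z (by simp) :
      Tendsto (fun τ : ℂ => z + τ • (w - z)) (𝓝 0) (𝓝 z)).eventually (ball_mem_nhds z hR)
  have hboth := hne.and hball
  rw [eventually_nhdsWithin_iff, Metric.nhds_basis_ball.eventually_iff] at hboth
  obtain ⟨ρ, hρ, hboth⟩ := hboth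
  obtain ⟨r, hs, hr⟩ := ((hu.eventually_hasSubmean hD hz (by simp [hm]) (w - z)).and
    (Ioo_mem_nhdsGT hρ)).exists
  by_contra! hcon
  have h1 := hs.le_circleAverage hr.1.le (T := fun _ => t) (circleIntegrable_const _ _ _)
    (fun τ hτ => by
      rw [mem_sphere_zero_iff_norm] at hτ
      have h2 := hboth (x := τ) (by rw [mem_ball_zero_iff, hτ]; exact hr.2)
        (by rw [mem_compl_singleton_iff, ← norm_ne_zero_iff, hτ]; exact hr.1.ne')
      have h3 := hRN h2.2
      exact hcon _ h3.1 h3.2 h2.1)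
  simp only [zero_smul, add_zero] at h1
  rw [hm, circleAverage_const, EReal.coe_le_coe_iff] at h1
  linarith

/-- The supremum of `u` over the fibre of `f|D` at `w`. -/
noncomputable def fibreSup (f : Cn n → Cn n) (D : Set (Cn n)) (u : Cn n → EReal) (w : Cn n) :
    EReal :=
  sSup (u '' {z ∈ D | f z = w})

theorem le_fibreSup {z : Cn n} (hz : z ∈ D) : u z ≤ fibreSup f D u (f z) :=
  le_sSup ⟨z, ⟨hz, rfl⟩, rfl⟩

theorem ProperOn.exists_eq_fibreSup (hf : ProperOn f D G) (hu : UpperSemicontinuousOn u D)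
    {w : Cn n} (hw : w ∈ G) (hne : ∃ z ∈ D, f z = w) :
    ∃ z ∈ D, f z = w ∧ u z = fibreSup f D u w := by
  have hc := hf.isCompact_preimage {w} (singleton_subset_iff.2 hw) isCompact_singleton
  obtain ⟨z₀, h1, h2⟩ := hne
  obtain ⟨z, hz, hmax⟩ := (hu.mono inter_subset_left).exists_isMaxOn (s := D ∩ f ⁻¹' {w})
    ⟨z₀, h1, h2⟩ hc
  refine ⟨z, hz.1, hz.2, le_antisymm (le_sSup ⟨z, ⟨hz.1, hz.2⟩, rfl⟩) (sSup_le ?_)⟩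
  rintro _ ⟨x, hx, rfl⟩
  exact hmax ⟨hx.1, hx.2⟩

theorem fibreSup_eq_bot_of_forall_ne {w : Cn n} (h : ∀ z ∈ D, f z ≠ w) : fibreSup f D u w = ⊥ := by
  have : {z ∈ D | f z = w} = ∅ := by
    ext z; simpa using h z
  simp [fibreSup, this]

theorem ProperOn.fibreSup_lt_top (hf : ProperOn f D G) (hu : PSHOn u D) {w : Cn n} (hw : w ∈ G) :
    fibreSup f D u w < ⊤ := by
  by_cases hne : ∃ z ∈ D, f z = w
  · obtain ⟨z, hz, _, h⟩ := hf.exists_eq_fibreSup hu.1 hw hne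
    exact h ▸ hu.2.1 z hz
  · push Not at hne
    rw [fibreSup_eq_bot_of_forall_ne hne]
    exact bot_lt_top

/-- By properness, the points over a closed ball with `u ≥ c'` form a compact set; its image is
closed and misses `w`. -/
theorem ProperOn.upperSemicontinuousOn_fibreSup (hf : ProperOn f D G) (hG : IsOpen G)
    (hu : UpperSemicontinuousOn u D) : UpperSemicontinuousOn (fibreSup f D u) G := by
  intro w hw c hc
  refine nhdsWithin_le_nhds ?_
  obtain ⟨c', h1, h2⟩ := exists_between hc
  obtain ⟨R, hR, hRG⟩ := Metric.nhds_basis_closedBall.mem_iff.1 (hG.mem_nhds hw)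
  have hA := (hu.mono inter_subset_left).isCompact_inter_preimage_Ici
    (hf.isCompact_preimage _ hRG (isCompact_closedBall w R)) c'
  set A := D ∩ f ⁻¹' closedBall w R ∩ u ⁻¹' Ici c'
  have hfA : IsCompact (f '' A) :=
    hA.image_of_continuousOn (hf.differentiableOn.continuousOn.mono fun z hz => hz.1.1)
  have hwA : w ∉ f '' A := by
    rintro ⟨z, hz, rfl⟩
    exact absurd ((hz.2 : c' ≤ u z).trans (le_fibreSup hz.1.1)) (not_le.2 h1)
  filter_upwards [hfA.isClosed.isOpen_compl.mem_nhds hwA, closedBall_mem_nhds w hR] with x hx hxR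
  refine lt_of_le_of_lt (sSup_le ?_) h2
  rintro _ ⟨z, ⟨hzD, rfl⟩, rfl⟩
  by_contra hlt
  exact hx ⟨z, ⟨⟨hzD, hxR⟩, (not_le.1 hlt).le⟩, rfl⟩

end SCV

/-! ### Subharmonicity of the fibre supremum along discs -/

namespace SCV
open Filter Topology Metric Real InnerProductSpace

theorem harmonicAt_comp_const_add {h : ℂ → ℝ} {ζ : ℂ} (hh : HarmonicAt h ζ) :
    HarmonicAt (fun τ => h (ζ + τ)) 0 := by
  obtain ⟨R, hR, hball⟩ := Metric.eventually_nhds_iff_ball.1 hh.eventually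
  obtain ⟨F, hF, hFh⟩ := InnerProductSpace.HarmonicOnNhd.exists_analyticOnNhd_ball_re_eq
    (f := h) (z := ζ) (R := R) hball
  have htr : Tendsto (fun τ : ℂ => ζ + τ) (𝓝 0) (𝓝 ζ) :=
    Continuous.tendsto' (by fun_prop) _ _ (by simp)
  have h1 : HarmonicAt (fun τ => (F (ζ + τ)).re) 0 := by
    apply AnalyticAt.harmonicAt_re
    refine AnalyticAt.comp (g := F) (f := fun τ : ℂ => ζ + τ) ?_ (by fun_prop)
    simpa using hF ζ (mem_ball_self hR)
  refine (harmonicAt_congr_nhds ?_).1 h1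
  filter_upwards [htr.eventually (ball_mem_nhds ζ hR)] with τ hτ
  exact hFh hτ

variable {n : ℕ} {f : Cn n → Cn n} {D G : Set (Cn n)} {u : Cn n → EReal} {ψ : ℂ → Cn n}

/-- Moving the point of the graph along `(τ a, τ)` with `f'(z) a = ψ'(ζ)`, the penalty
`‖f z - ψ ζ‖ ^ 2` has no second order term in the mean. -/
theorem not_eventually_le_of_penalty (hu : PSHOn u D) (hD : IsOpen D)
    (hf : DifferentiableOn ℂ f D) {U : Set ℂ} (hU : IsOpen U) (hψ : DifferentiableOn ℂ ψ U)
    {z₁ : Cn n} {ζ₁ : ℂ} (hz₁ : z₁ ∈ D) (hζ₁ : ζ₁ ∈ U) (hJ : jac f z₁ ≠ 0) {m : ℝ}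
    (hm : u z₁ = m) {h : ℂ → ℝ} (hh : HarmonicAt h ζ₁) {ε k δ : ℝ} (hε : 0 < ε) (hk : 0 ≤ k)
    (ζ₀ : ℂ) {T : Cn n → ℂ → ℝ} (hT : ∀ z ζ, T z ζ = -h ζ + ε * ‖ζ - ζ₀‖ ^ 2 -
      k * ‖f z - ψ ζ‖ ^ 2 + δ * Real.log ‖jac f z‖) :
    ¬ ∀ᶠ p : Cn n × ℂ in 𝓝 (z₁, ζ₁), u p.1 ≤ ((m + T z₁ ζ₁ - T p.1 p.2 : ℝ) : EReal) := by
  intro hev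
  obtain ⟨a, ha⟩ := exists_fderiv_eq_of_jac_ne_zero hJ (deriv ψ ζ₁)
  have hline : Continuous fun τ : ℂ => z₁ + τ • a := by fun_prop
  have htr : Tendsto (fun τ : ℂ => (z₁ + τ • a, ζ₁ + τ)) (𝓝 0) (𝓝 (z₁, ζ₁)) :=
    Continuous.tendsto' (by fun_prop) _ _ (by simp)
  have hder1 := DifferentiableAt.hasDerivAt_line (f := f) (z := z₁) (a := a) (τ := 0)
    (hf.differentiableAt (hD.mem_nhds (by simpa using hz₁)))
  simp only [zero_smul, add_zero, ha] at hder1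
  have hψd : HasDerivAt ψ (deriv ψ ζ₁) (ζ₁ + 0) := by
    rw [add_zero]
    exact (hψ.differentiableAt (hU.mem_nhds hζ₁)).hasDerivAt
  have hder2 : HasDerivAt (fun τ : ℂ => ψ (ζ₁ + τ)) (deriv ψ ζ₁) 0 := hψd.comp_const_add ζ₁ 0
  have han1 : AnalyticAt ℂ (fun τ : ℂ => f (z₁ + τ • a)) 0 := by
    refine DifferentiableOn.analyticAt (s := {τ : ℂ | z₁ + τ • a ∈ D}) ?_
      ((hD.preimage hline).mem_nhds (by simpa using hz₁))
    exact hf.comp (by fun_prop) fun τ hτ => hτ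
  have han2 : AnalyticAt ℂ (fun τ : ℂ => ψ (ζ₁ + τ)) 0 := by
    refine AnalyticAt.comp (g := ψ) (f := fun τ : ℂ => ζ₁ + τ) ?_ (by fun_prop)
    simpa using hψ.analyticAt (hU.mem_nhds hζ₁)
  have hlog : HarmonicAt (fun τ : ℂ => Real.log ‖jac f (z₁ + τ • a)‖) 0 :=
    (analyticAt_jac_line hD hf (by simpa using hz₁)).harmonicAt_log_norm (by simpa using hJ)
  have hq := (harmonicAt_comp_const_add hh).sub (hlog.const_smul (c := δ))
  have hH1 : HasDerivAt (fun τ : ℂ => f (z₁ + τ • a) - ψ (ζ₁ + τ) - (f z₁ - ψ ζ₁)) 0 0 := by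
    simpa using (hder1.sub hder2).sub_const (f z₁ - ψ ζ₁)
  refine not_eventually_le_of_hasSubmean
    (hu.eventually_hasSubmean hD hz₁ (by simp [hm]) a) (m := m) (by simpa using hm) hq
    ((han1.sub han2).sub (analyticAt_const (v := f z₁ - ψ ζ₁))) (by simp) hH1
    (f z₁ - ψ ζ₁) hε hk (ζ₁ - ζ₀) (a := (1 : ℂ)) one_ne_zero ?_
  filter_upwards [htr.eventually hev] with τ hτ
  refine hτ.trans (EReal.coe_le_coe_iff.2 (le_of_eq ?_))
  rw [hT, hT]
  have h1 : f z₁ - ψ ζ₁ + (f (z₁ + τ • a) - ψ (ζ₁ + τ) - (f z₁ - ψ ζ₁)) =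
    f (z₁ + τ • a) - ψ (ζ₁ + τ) := by abel
  have h2 : ζ₁ - ζ₀ + τ • (1 : ℂ) = ζ₁ + τ - ζ₀ := by rw [smul_eq_mul]; ring
  simp only [Pi.sub_apply, Pi.smul_apply, smul_eq_mul, zero_smul, add_zero, h1]
  rw [← h2]
  simp only [smul_eq_mul]
  ring

theorem isClosed_coe_le {X : Type*} [TopologicalSpace X] {v : X → EReal} {K : Set X}
    (hK : IsClosed K) (hv : UpperSemicontinuousOn v K) {T : X → ℝ} (hT : ContinuousOn T K) :
    IsClosed {x ∈ K | (T x : EReal) ≤ v x} := by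
  have h := (upperSemicontinuousOn_iff_isClosed_hypograph hK).1 hv
  have h2 : ContinuousOn (fun x => (x, (T x : EReal))) K :=
    continuousOn_id.prodMk (continuous_coe_real_ereal.comp_continuousOn hT)
  convert! h2.preimage_isClosed_of_isClosed hK h using 1
  ext x
  simp only [mem_ofPred_eq, mem_inter_iff, mem_preimage]
  tauto

/-- For a large penalty, the penalised function is small wherever `ζ` is on the boundary circle or
`f z` is away from `ψ ζ`. -/
theorem exists_penalty {X : Type*} [TopologicalSpace X] {v : X → EReal} {B : Set X}
    (hB : IsCompact B) (hBc : IsClosed B) (hv : UpperSemicontinuousOn v B)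
    (htop : ∀ x ∈ B, v x < ⊤)
    {T P : X → ℝ} (hT : ContinuousOn T B) (hP : ContinuousOn P B) (hP0 : ∀ x ∈ B, 0 ≤ P x)
    (hlt : ∀ x ∈ B, P x = 0 → v x < T x) :
    ∃ k : ℕ, ∀ x ∈ B, v x < ((T x + k * P x : ℝ) : EReal) := by
  by_contra! hcon
  set S : ℕ → Set X := fun k => {x ∈ B | ((T x + k * P x : ℝ) : EReal) ≤ v x} with hS
  have hScl : ∀ k, IsClosed (S k) := fun k =>
    isClosed_coe_le hBc hv (hT.add (continuousOn_const.mul hP))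
  have hne := IsCompact.nonempty_iInter_of_sequence_nonempty_isCompact_isClosed S
    (fun k x hx => ⟨hx.1, le_trans (EReal.coe_le_coe_iff.2 (by
      have := hP0 x hx.1
      push_cast
      linarith)) hx.2⟩)
    (fun k => by obtain ⟨x, hx, h⟩ := hcon k; exact ⟨x, hx, h⟩)
    (hB.of_isClosed_subset (hScl 0) fun x hx => hx.1) hScl
  obtain ⟨x, hx⟩ := hne
  rw [mem_iInter] at hx
  have hxB := (hx 0).1
  have hfin : P x = 0 := by
    refine le_antisymm ?_ (hP0 x hxB)
    by_contra! hpos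
    obtain ⟨M, hM1, -⟩ := EReal.lt_iff_exists_real_btwn.1 (htop x hxB)
    obtain ⟨k, hk⟩ := exists_nat_gt ((M - T x) / P x)
    have h1 := (hx k).2.trans_lt hM1
    rw [EReal.coe_lt_coe_iff] at h1
    rw [div_lt_iff₀ hpos] at hk
    linarith
  have h2 := (hx 0).2
  simp only [hfin, mul_zero, add_zero] at h2
  exact absurd (hlt x hxB hfin) (not_lt.2 h2)

/-- The supremum of a plurisubharmonic function over the fibres of a proper holomorphic map,
along a holomorphic disc, is not touched from above by strictly superharmonic functions. -/
theorem ProperOn.noTouch_fibreSup (hf : ProperOn f D G) (hG : IsOpen G)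
    (hJ : ∀ z ∈ D, ¬ ∀ᶠ w in 𝓝 z, jac f w = 0) (hu : PSHOn u D) {U : Set ℂ} (hU : IsOpen U)
    (hψ : DifferentiableOn ℂ ψ U) (hψG : MapsTo ψ U G) {ζ₀ : ℂ} (hζ₀ : ζ₀ ∈ U) :
    NoTouch (fun ζ => fibreSup f D u (ψ ζ)) ζ₀ := by
  intro m hm h hh ε hε hev
  have hfc := hf.differentiableOn.continuousOn
  have hD := hf.isOpen
  obtain ⟨ρ, hρ, hball⟩ := Metric.nhds_basis_closedBall.eventually_iff.1
    ((hev.and hh.eventually).and (hU.eventually_mem hζ₀))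
  have hζB : ζ₀ ∈ closedBall ζ₀ ρ := mem_closedBall_self hρ.le
  have hψc : ContinuousOn ψ (closedBall ζ₀ ρ) :=
    hψ.continuousOn.mono fun ζ hζ => (hball hζ).2
  have hhc : ContinuousOn h (closedBall ζ₀ ρ) := fun ζ hζ =>
    (hball hζ).1.2.1.continuousAt.continuousWithinAt
  have hψB : IsCompact (ψ '' closedBall ζ₀ ρ) := (isCompact_closedBall _ _).image_of_continuousOn hψc
  obtain ⟨C, hC, hBC, hCG⟩ := exists_compact_between hψB hG
    (image_subset_iff.2 fun ζ hζ => hψG (hball hζ).2)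
  obtain ⟨L, hL⟩ : ∃ L, L = D ∩ f ⁻¹' C := ⟨_, rfl⟩
  have hLc : IsCompact L := hL ▸ hf.isCompact_preimage C hCG hC
  have hLD : L ⊆ D := hL ▸ inter_subset_left
  obtain ⟨z₀, hz₀, hfz₀, huz₀⟩ := hf.exists_eq_fibreSup hu.1 (hψG hζ₀) (by
    by_contra! hne
    dsimp only at hm
    rw [fibreSup_eq_bot_of_forall_ne hne] at hm
    exact EReal.coe_ne_bot _ hm.symm)
  dsimp only at hm
  rw [hm] at huz₀
  have hKc : IsCompact (L ×ˢ closedBall ζ₀ ρ) := hLc.prod (isCompact_closedBall _ _)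
  have hu1 : UpperSemicontinuousOn (fun p : Cn n × ℂ => u p.1) (L ×ˢ closedBall ζ₀ ρ) :=
    (hu.1.mono hLD).comp continuousOn_fst fun p hp => hp.1
  have hutop : ∀ p ∈ L ×ˢ closedBall ζ₀ ρ, u p.1 < ⊤ := fun p hp => hu.2.1 _ (hLD hp.1)
  have hf1 : ContinuousOn (fun p : Cn n × ℂ => f p.1) (L ×ˢ closedBall ζ₀ ρ) :=
    (hfc.mono hLD).comp continuousOn_fst fun p hp => hp.1
  have hh1 : ContinuousOn (fun p : Cn n × ℂ => h p.2) (L ×ˢ closedBall ζ₀ ρ) :=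
    hhc.comp continuousOn_snd fun p hp => hp.2
  have hψ1 : ContinuousOn (fun p : Cn n × ℂ => ψ p.2) (L ×ˢ closedBall ζ₀ ρ) :=
    hψc.comp continuousOn_snd fun p hp => hp.2
  -- Only half of `ε` is spent on the new quadratic term. Where `f z = ψ ζ` and `ζ` is on the
  -- circle, the penalised value is therefore at least `2 η` below `m - h ζ₀`.
  set η := ε * ρ ^ 2 / 4 with hη
  have hη0 : 0 < η := by positivity
  -- the penalised function is small on the boundary
  set B : Set (Cn n × ℂ) :=
    {p ∈ L ×ˢ closedBall ζ₀ ρ | dist p.2 ζ₀ = ρ ∨ f p.1 ∈ (interior C)ᶜ} with hB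
  have hBsub : B ⊆ L ×ˢ closedBall ζ₀ ρ := fun p hp => hp.1
  have hBcl : IsClosed B := by
    have h1 : IsClosed {p ∈ L ×ˢ closedBall ζ₀ ρ | dist p.2 ζ₀ = ρ} :=
      (by fun_prop : ContinuousOn (fun p : Cn n × ℂ => dist p.2 ζ₀) _).preimage_isClosed_of_isClosed
        hKc.isClosed isClosed_singleton
    have h2 : IsClosed {p ∈ L ×ˢ closedBall ζ₀ ρ | f p.1 ∈ (interior C)ᶜ} :=
      hf1.preimage_isClosed_of_isClosed hKc.isClosed isOpen_interior.isClosed_compl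
    convert! h1.union h2 using 1
    ext p
    simp only [hB, mem_ofPred_eq, mem_union]
    tauto
  obtain ⟨k, hk⟩ := exists_penalty (hKc.of_isClosed_subset hBcl hBsub) hBcl (hu1.mono hBsub)
    (fun p hp => hutop p (hBsub hp))
    (T := fun p => m - η + h p.2 - h ζ₀ - ε / 2 * ‖p.2 - ζ₀‖ ^ 2)
    (P := fun p => ‖f p.1 - ψ p.2‖ ^ 2)
    (((continuousOn_const.add (hh1.mono hBsub)).sub continuousOn_const).sub (by fun_prop))
    (((hf1.mono hBsub).sub (hψ1.mono hBsub)).norm.pow 2)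
    (fun p _ => by positivity)
    (by
      rintro p ⟨hpK, hp⟩ hp0
      have hfp : f p.1 = ψ p.2 := by
        simpa [sub_eq_zero] using hp0
      have hpd : dist p.2 ζ₀ = ρ := hp.resolve_right fun h1 =>
        h1 (hfp ▸ hBC (mem_image_of_mem ψ hpK.2))
      have h1 : u p.1 ≤ fibreSup f D u (ψ p.2) := hfp ▸ le_fibreSup (hLD hpK.1)
      refine (h1.trans (hball hpK.2).1.1).trans_lt (EReal.coe_lt_coe_iff.2 ?_)
      rw [dist_eq_norm] at hpd
      rw [hpd]
      nlinarith)
  set T₀ : Cn n → ℂ → ℝ := fun z ζ => -h ζ + ε / 2 * ‖ζ - ζ₀‖ ^ 2 - k * ‖f z - ψ ζ‖ ^ 2 with hT₀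
  have hT₀c : ContinuousOn (fun p : Cn n × ℂ => T₀ p.1 p.2) (L ×ˢ closedBall ζ₀ ρ) :=
    (hh1.neg.add (by fun_prop)).sub (continuousOn_const.mul ((hf1.sub hψ1).norm.pow 2))
  have hbd : ∀ p ∈ B, u p.1 < ((m - η - h ζ₀ - T₀ p.1 p.2 : ℝ) : EReal) := fun p hp => by
    refine (hk p hp).trans_le (EReal.coe_le_coe_iff.2 (le_of_eq ?_))
    simp only [hT₀]; ring
  obtain ⟨M, hM⟩ : ∃ M, ∀ p ∈ L ×ˢ closedBall ζ₀ ρ, ∀ x : ℝ, u p.1 = x → x + T₀ p.1 p.2 ≤ M := by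
    obtain ⟨M₁, hM₁⟩ := exists_real_bound hKc hu1 hutop
    obtain ⟨M₂, hM₂⟩ := hKc.exists_bound_of_continuousOn hT₀c
    refine ⟨M₁ + M₂, fun p hp x hx => ?_⟩
    have h1 := hM₁ p hp
    rw [hx, EReal.coe_le_coe_iff] at h1
    have h2 := (le_abs_self _).trans (hM₂ p hp)
    linarith
  have hJc : ContinuousOn (jac f) L := (continuousOn_jac hD hf.differentiableOn).mono hLD
  obtain ⟨Λ, hΛ0, hΛ⟩ : ∃ Λ > 0, ∀ z ∈ L, ‖jac f z‖ ≤ Λ := by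
    obtain ⟨Λ, hΛ⟩ := hLc.exists_bound_of_continuousOn hJc
    exact ⟨max Λ 1, by positivity, fun z hz => (hΛ z hz).trans (le_max_left _ _)⟩
  -- a competitor at which the Jacobian does not vanish
  have hN : D ∩ f ⁻¹' (interior C ∩ {w | k * ‖w - ψ ζ₀‖ ^ 2 < η / 4}) ∈ 𝓝 z₀ := by
    refine inter_mem (hD.mem_nhds hz₀) ((hfc.continuousAt (hD.mem_nhds hz₀)) ?_)
    refine IsOpen.mem_nhds (isOpen_interior.inter
      (isOpen_lt (by fun_prop) continuous_const)) ⟨?_, ?_⟩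
    · rw [hfz₀]; exact hBC (mem_image_of_mem ψ hζB)
    · simp only [mem_ofPred_eq, hfz₀, sub_self, norm_zero]
      rw [zero_pow two_ne_zero, mul_zero]
      positivity
  obtain ⟨z', hz'N, hz'D, hz'J, hz'u⟩ := hu.exists_jac_ne_zero_near hD hf.differentiableOn hJ hz₀
    huz₀ (by linarith : m - η / 4 < m) hN
  have hz'L : z' ∈ L := by rw [hL]; exact ⟨hz'D, interior_subset (s := C) hz'N.2.1⟩
  have hz'J0 : 0 < ‖jac f z'‖ := norm_pos_iff.2 hz'J
  -- The competitor `(z', ζ₀)` loses less than `η / 4` in each of `u`, the penalty and the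
  -- normalised logarithm, so it stays above the boundary level `m - η - h ζ₀`.
  obtain ⟨δ, hδ0, hδ⟩ : ∃ δ > 0, -(η / 4) < δ * (Real.log ‖jac f z'‖ - Real.log Λ) := by
    have h1 : Real.log ‖jac f z'‖ - Real.log Λ ≤ 0 := by
      have := Real.log_le_log hz'J0 (hΛ z' hz'L)
      linarith
    refine ⟨η / 4 / (Real.log Λ - Real.log ‖jac f z'‖ + 1), div_pos (by positivity) (by linarith), ?_⟩
    rw [div_mul_eq_mul_div, lt_div_iff₀ (by linarith)]
    nlinarith
  -- Restricting to `‖jac f z‖ ≥ κ` keeps the logarithm continuous; `κ` is so small that the maximum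
  -- cannot lie on the artificial boundary `‖jac f z‖ = κ`.
  obtain ⟨κ, hκ0, hκz', hκ⟩ : ∃ κ > 0, κ ≤ ‖jac f z'‖ ∧
      M + δ * (Real.log κ - Real.log Λ) < m - η - h ζ₀ := by
    set y := Real.log Λ + (m - η - h ζ₀ - M - 1) / δ with hy
    refine ⟨min ‖jac f z'‖ (Real.exp y), lt_min hz'J0 (exp_pos _), min_le_left _ _, ?_⟩
    have h1 : Real.log (min ‖jac f z'‖ (Real.exp y)) ≤ y := by
      rw [← Real.log_exp y]
      refine Real.log_le_log (lt_min hz'J0 (exp_pos _)) ?_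
      rw [Real.log_exp]
      exact min_le_right _ _
    have h2 : δ * (y - Real.log Λ) = m - η - h ζ₀ - M - 1 := by
      rw [hy]; field_simp; ring
    have h3 : δ * (Real.log (min ‖jac f z'‖ (Real.exp y)) - Real.log Λ) ≤ δ * (y - Real.log Λ) := by
      gcongr
    linarith
  set K' : Set (Cn n × ℂ) := {p ∈ L ×ˢ closedBall ζ₀ ρ | jac f p.1 ∈ {w | κ ≤ ‖w‖}} with hK'
  have hJ1 : ContinuousOn (fun p : Cn n × ℂ => jac f p.1) (L ×ˢ closedBall ζ₀ ρ) :=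
    hJc.comp continuousOn_fst fun p hp => hp.1
  have hK'cl : IsClosed K' := hJ1.preimage_isClosed_of_isClosed hKc.isClosed
    (isClosed_le continuous_const continuous_norm)
  have hK'sub : K' ⊆ L ×ˢ closedBall ζ₀ ρ := fun p hp => hp.1
  obtain ⟨T, hT⟩ : ∃ T : Cn n → ℂ → ℝ, ∀ z ζ, T z ζ = T₀ z ζ + δ * Real.log ‖jac f z‖ :=
    ⟨_, fun _ _ => rfl⟩
  have hTc : ContinuousOn (fun p : Cn n × ℂ => T p.1 p.2) K' := by
    simp only [hT]
    refine (hT₀c.mono hK'sub).add (continuousOn_const.mul ?_)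
    exact (hJ1.mono hK'sub).norm.log fun p hp => (hκ0.trans_le hp.2).ne'
  have hz'K : (z', ζ₀) ∈ K' := ⟨⟨hz'L, hζB⟩, hκz'⟩
  obtain ⟨⟨z₁, ζ₁⟩, hp₁, m₁, hm₁, hmax⟩ := exists_max_add
    (hKc.of_isClosed_subset hK'cl hK'sub) (hu1.mono hK'sub) (fun p hp => hutop p (hK'sub hp))
    hTc hz'K ((EReal.bot_lt_coe _).trans hz'u).ne'
  dsimp only at hm₁ hmax
  have hp₁K := hK'sub hp₁
  have hJz₁ : 0 < ‖jac f z₁‖ := hκ0.trans_le hp₁.2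
  have hbig : m - η - h ζ₀ < m₁ + T₀ z₁ ζ₁ + δ * (Real.log ‖jac f z₁‖ - Real.log Λ) := by
    have h1 := hz'u.trans_le (hmax _ hz'K)
    rw [EReal.coe_lt_coe_iff, hT, hT] at h1
    have h2 : k * ‖f z' - ψ ζ₀‖ ^ 2 < η / 4 := hz'N.2.2
    have h3 : T₀ z' ζ₀ = - h ζ₀ - k * ‖f z' - ψ ζ₀‖ ^ 2 := by
      simp [hT₀]
    linarith
  have hlogle : δ * (Real.log ‖jac f z₁‖ - Real.log Λ) ≤ 0 := by
    have := Real.log_le_log hJz₁ (hΛ z₁ hp₁K.1)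
    exact mul_nonpos_of_nonneg_of_nonpos hδ0.le (by linarith)
  have hnotB : (z₁, ζ₁) ∉ B := fun hB1 => by
    have h1 := hbd _ hB1
    dsimp only at h1
    rw [hm₁, EReal.coe_lt_coe_iff] at h1
    linarith
  have hκz₁ : κ < ‖jac f z₁‖ := by
    refine lt_of_le_of_ne hp₁.2 fun heq => ?_
    have h1 := hM _ hp₁K m₁ hm₁
    dsimp only at h1
    rw [← heq] at hbig
    linarith
  have hζ₁ : ζ₁ ∈ ball ζ₀ ρ := lt_of_le_of_ne hp₁K.2 fun heq => hnotB ⟨hp₁K, Or.inl heq⟩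
  have hfz₁ : f z₁ ∈ interior C := by
    by_contra hcon
    exact hnotB ⟨hp₁K, Or.inr hcon⟩
  have hz₁D := hLD hp₁K.1
  refine not_eventually_le_of_penalty hu hD hf.differentiableOn hU hψ hz₁D
    (hball hp₁K.2).2 (norm_pos_iff.1 hJz₁) hm₁ (hball hp₁K.2).1.2 (half_pos hε)
    (Nat.cast_nonneg k) ζ₀ (T := T) (δ := δ) (fun z ζ => by rw [hT]) ?_
  have hev1 : ∀ᶠ z in 𝓝 z₁, z ∈ L ∧ κ ≤ ‖jac f z‖ := by
    have hDn := hD.mem_nhds hz₁D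
    filter_upwards [hDn, (hfc.continuousAt hDn) (isOpen_interior.mem_nhds hfz₁),
      ((continuousOn_jac hD hf.differentiableOn).continuousAt hDn).norm.eventually_const_lt hκz₁]
      with z h1 h2 h3
    exact ⟨by rw [hL]; exact ⟨h1, interior_subset (s := C) h2⟩, h3.le⟩
  rw [nhds_prod_eq]
  filter_upwards [hev1.prod_mk (isOpen_ball.eventually_mem hζ₁)] with p hp
  exact hmax p ⟨⟨hp.1.1, ball_subset_closedBall hp.2⟩, hp.1.2⟩

/-- `fibreSup` is subharmonic along holomorphic discs. -/
theorem ProperOn.hasSubmean_fibreSup (hf : ProperOn f D G) (hG : IsOpen G)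
    (hJ : ∀ z ∈ D, ¬ ∀ᶠ w in 𝓝 z, jac f w = 0) (hu : PSHOn u D) {U : Set ℂ} (hU : IsOpen U)
    (hψ : DifferentiableOn ℂ ψ U) (hψG : MapsTo ψ U G) {c : ℂ} {r : ℝ} (hr : 0 < r)
    (hc : closedBall c r ⊆ U) (hb : fibreSup f D u (ψ c) ≠ ⊥) :
    HasSubmean (fun ζ => fibreSup f D u (ψ ζ)) c r :=
  hasSubmean_of_noTouch hr
    (((hf.upperSemicontinuousOn_fibreSup hG hu.1).comp hψ.continuousOn hψG).mono hc)
    (fun _ hz => hf.fibreSup_lt_top hu (hψG (hc hz)))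
    (fun _ hz => hf.noTouch_fibreSup hG hJ hu hU hψ hψG (hc (ball_subset_closedBall hz))) hb

end SCV

/-! ### Strong maximum principle and surjectivity of proper maps -/

namespace SCV
open Filter Topology Metric Real InnerProductSpace

variable {n : ℕ} {f : Cn n → Cn n} {D G : Set (Cn n)} {u : Cn n → EReal}

theorem subharmonicOn_zero (U : Set ℂ) : SubharmonicOn (fun _ => 0) U :=
  ⟨upperSemicontinuousOn_const, by simp, fun c r _ _ => by simp [circleMean]⟩

theorem pshOn_zero (D : Set (Cn n)) : PSHOn (fun _ => 0) D :=
  ⟨upperSemicontinuousOn_const, by simp, fun _ _ => subharmonicOn_zero _⟩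

/-- The point `w` is the value at `τ = 1` of the disc `τ ↦ z₀ + τ (w - z₀)`, so the maximum
principle on the unit circle reaches it directly. -/
theorem eq_on_ball_of_le {v : Cn n → EReal} {z₀ : Cn n} {R : ℝ}
    (husc : UpperSemicontinuousOn v (ball z₀ R))
    (hsub : ∀ w ∈ ball z₀ R, HasSubmean (fun τ : ℂ => v (z₀ + τ • (w - z₀))) 0 1)
    (hb : v z₀ ≠ ⊥) (ht : v z₀ ≠ ⊤) (hle : ∀ w ∈ ball z₀ R, v w ≤ v z₀) :
    ∀ w ∈ ball z₀ R, v w = v z₀ := by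
  intro w hw
  have hmaps : MapsTo (fun τ : ℂ => z₀ + τ • (w - z₀)) (sphere 0 1) (ball z₀ R) := by
    intro τ hτ
    rw [mem_ball, dist_eq_norm] at hw ⊢
    rw [mem_sphere_zero_iff_norm] at hτ
    rwa [add_sub_cancel_left, norm_smul, hτ, one_mul]
  have h := (hsub w hw).eq_of_le zero_le_one
    (husc.comp (by fun_prop) hmaps) (by simpa using hb) (by simpa using ht)
    (fun τ hτ => by simpa using hle _ (hmaps hτ)) 1 (by simp)
  simpa using h

theorem closedBall_zero_one_line_mem {z₀ w : Cn n} {R : ℝ} (hw : w ∈ ball z₀ R) {τ : ℂ}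
    (hτ : τ ∈ closedBall (0 : ℂ) 1) : z₀ + τ • (w - z₀) ∈ ball z₀ R := by
  rw [mem_ball, dist_eq_norm] at hw ⊢
  rw [mem_closedBall_zero_iff] at hτ
  rw [add_sub_cancel_left, norm_smul]
  exact (mul_le_of_le_one_left (norm_nonneg _) hτ).trans_lt hw

theorem PSHOn.hasSubmean_line (hu : PSHOn u D) {z₀ w : Cn n} {R : ℝ} (hR : ball z₀ R ⊆ D)
    (hw : w ∈ ball z₀ R) (hb : u z₀ ≠ ⊥) :
    HasSubmean (fun τ : ℂ => u (z₀ + τ • (w - z₀))) 0 1 :=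
  (hu.2.2 z₀ (w - z₀)).hasSubmean one_pos
    (fun _ hτ => hR (closedBall_zero_one_line_mem hw hτ)) (by simpa using hb)

/-- The strong maximum principle. -/
theorem PSHOn.eq_of_le (hu : PSHOn u D) (hD : IsOpen D) (hc : IsPreconnected D) {z₀ : Cn n}
    (hz₀ : z₀ ∈ D) (hle : ∀ z ∈ D, u z ≤ u z₀) : ∀ z ∈ D, u z = u z₀ := by
  by_cases hb : u z₀ = ⊥
  · intro z hz
    rw [hb]
    exact le_bot_iff.1 (hb ▸ hle z hz)
  set S := {z ∈ D | u z = u z₀}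
  have hS : IsOpen S := by
    refine isOpen_iff_mem_nhds.2 fun z hz => ?_
    obtain ⟨R, hR, hRD⟩ := Metric.isOpen_iff.1 hD z hz.1
    have h := eq_on_ball_of_le (hu.1.mono hRD) (fun w hw => hu.hasSubmean_line hRD hw
      (by rw [hz.2]; exact hb)) (by rw [hz.2]; exact hb) (hu.2.1 z hz.1).ne
      (fun w hw => by rw [hz.2]; exact hle w (hRD hw))
    exact mem_of_superset (ball_mem_nhds z hR) fun w hw => ⟨hRD hw, (h w hw).trans hz.2⟩
  have hsub : D ⊆ S := by
    refine hc.subset_of_closure_inter_subset hS ⟨z₀, hz₀, hz₀, rfl⟩ ?_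
    rintro z ⟨hz, hzD⟩
    refine ⟨hzD, le_antisymm (hle z hzD) (not_lt.1 fun hlt => ?_)⟩
    have hev := hu.1 z hzD _ hlt
    rw [hD.nhdsWithin_eq hzD] at hev
    obtain ⟨y, hy1, hy2⟩ := mem_closure_iff_nhds.1 hz _ hev
    exact absurd hy2.2 (ne_of_lt hy1)
  exact fun z hz => (hsub hz).2

/-- A proper holomorphic map between domains of the same dimension is surjective. -/
theorem ProperOn.surjOn (hf : ProperOn f D G) (hG : IsOpen G) (hGc : IsPreconnected G)
    (hne : D.Nonempty) (hJ : ∀ z ∈ D, ¬ ∀ᶠ w in 𝓝 z, jac f w = 0) : SurjOn f D G := by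
  -- The pushforward of the zero function is `0` on the image of `f` and `-∞` off it. The maximum
  -- principle makes the image open, and upper semicontinuity makes it relatively closed.
  have hu := pshOn_zero D
  have hv0 : ∀ z ∈ D, fibreSup f D (fun _ => 0) (f z) = 0 := fun z hz => by
    refine le_antisymm (sSup_le ?_) (le_fibreSup (u := fun _ => 0) hz)
    rintro _ ⟨x, -, rfl⟩
    exact le_rfl
  have hvle : ∀ w, fibreSup f D (fun _ => 0) w ≤ 0 := fun w => by
    refine sSup_le ?_
    rintro _ ⟨x, -, rfl⟩
    exact le_rfl
  have husc := hf.upperSemicontinuousOn_fibreSup hG hu.1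
  have hopen : IsOpen (f '' D) := by
    refine isOpen_iff_mem_nhds.2 ?_
    rintro _ ⟨z, hz, rfl⟩
    obtain ⟨R, hR, hRG⟩ := Metric.isOpen_iff.1 hG _ (hf.mapsTo hz)
    have h := eq_on_ball_of_le (v := fibreSup f D (fun _ => 0)) (husc.mono hRG)
      (fun w hw => ?_) (by rw [hv0 z hz]; simp) (by rw [hv0 z hz]; simp)
      (fun w _ => by rw [hv0 z hz]; exact hvle w)
    · refine mem_of_superset (ball_mem_nhds _ hR) fun w hw => ?_
      by_contra hcon
      have h1 := h w hw
      rw [hv0 z hz, fibreSup_eq_bot_of_forall_ne fun x hx hxw => hcon ⟨x, hx, hxw⟩] at h1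
      exact EReal.bot_ne_zero h1
    · have hline : Continuous fun τ : ℂ => f z + τ • (w - f z) := by fun_prop
      refine hf.hasSubmean_fibreSup hG hJ hu (ψ := fun τ : ℂ => f z + τ • (w - f z))
        (hG.preimage hline) (by fun_prop) (fun τ hτ => hτ) one_pos
        (fun τ hτ => hRG (closedBall_zero_one_line_mem hw hτ)) ?_
      simp [hv0 z hz]
  obtain ⟨z₀, hz₀⟩ := hne
  refine hGc.subset_of_closure_inter_subset hopen ⟨f z₀, hf.mapsTo hz₀, mem_image_of_mem f hz₀⟩ ?_
  rintro w ⟨hw, hwG⟩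
  by_contra hcon
  have hbot : fibreSup f D (fun _ => 0) w < 0 := by
    rw [fibreSup_eq_bot_of_forall_ne fun x hx hxw => hcon ⟨x, hx, hxw⟩]
    exact EReal.bot_lt_zero
  have hev := husc w hwG _ hbot
  rw [hG.nhdsWithin_eq hwG] at hev
  obtain ⟨_, hy1, z, hz, rfl⟩ := mem_closure_iff_nhds.1 hw _ hev
  exact absurd (hv0 z hz) (ne_of_lt hy1)

/-! ### Null sets, pluripolar sets and thin sets -/

section Null

variable {E : Type*} [NormedAddCommGroup E] [NormedSpace ℂ E] [FiniteDimensional ℂ E]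
  [MeasurableSpace E] [BorelSpace E] (μ : Measure E) [μ.IsAddHaarMeasure]

theorem measure_preimage_smul_eq_zero_iff {c : ℂ} (hc : c ≠ 0) (s : Set E) :
    μ ((fun x => c • x) ⁻¹' s) = 0 ↔ μ s = 0 := by
  have : FiniteDimensional ℝ E := FiniteDimensional.complexToReal E
  let e : E ≃L[ℝ] E := (ContinuousLinearEquiv.smulLeft (R₁ := ℂ) (Units.mk0 c hc)).restrictScalars ℝ
  have h := Measure.addHaar_preimage_continuousLinearEquiv μ e s
  have he : (e ⁻¹' s) = (fun x => c • x) ⁻¹' s := rfl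
  rw [he] at h
  rw [h, mul_eq_zero, or_iff_right]
  simpa using (LinearEquiv.isUnit_det' e.symm.toLinearEquiv).ne_zero

/-- A set is null if and only if almost every orbit of the rotations meets it in a null set. -/
theorem measure_eq_zero_iff_ae_ae_circleMap {N : Set E} (hN : MeasurableSet N) :
    μ N = 0 ↔ ∀ᵐ x ∂μ, ∀ᵐ θ ∂volume.restrict (Ioc 0 (2 * π)), circleMap 0 1 θ • x ∉ N := by
  have : FiniteDimensional ℝ E := FiniteDimensional.complexToReal E
  have : ProperSpace E := FiniteDimensional.proper ℂ E
  have : SecondCountableTopology E := secondCountable_of_proper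
  have hm : MeasurableSet {p : E × ℝ | circleMap 0 1 p.2 • p.1 ∉ N} := by
    have hcont : Continuous fun p : E × ℝ => circleMap 0 1 p.2 • p.1 := by fun_prop
    exact (hcont.measurable hN).compl
  rw [Measure.ae_ae_comm hm]
  have key : ∀ θ, (∀ᵐ x ∂μ, circleMap 0 1 θ • x ∉ N) ↔ μ N = 0 := by
    intro θ
    rw [← measure_preimage_smul_eq_zero_iff μ (c := circleMap 0 1 θ) (by simp), ae_iff]
    simp [preimage]
  simp only [key]
  constructor
  · intro h
    exact ae_of_all _ fun _ => h
  · intro h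
    have : NeBot (ae (volume.restrict (Ioc 0 (2 * π)))) := by
      rw [ae_neBot, Ne, Measure.restrict_eq_zero]
      simp [pi_pos]
    exact h.exists.choose_spec

end Null

theorem measurableSet_eq_bot {X : Type*} [TopologicalSpace X] [MeasurableSpace X] [BorelSpace X]
    {w : X → EReal} {V : Set X} (hV : IsOpen V) (hw : UpperSemicontinuousOn w V) :
    MeasurableSet {z ∈ V | w z = ⊥} := by
  have h : {z ∈ V | w z = ⊥} = ⋂ k : ℕ, {z ∈ V | w z < ((-(k : ℝ) : ℝ) : EReal)} := by
    ext z
    simp only [mem_ofPred_eq, mem_iInter]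
    constructor
    · rintro ⟨h1, h2⟩ k
      exact ⟨h1, h2 ▸ EReal.bot_lt_coe _⟩
    · intro h
      refine ⟨(h 0).1, ?_⟩
      by_contra hb
      have htop : w z ≠ ⊤ := ((h 0).2.trans (EReal.coe_lt_top _)).ne
      obtain ⟨k, hk⟩ := exists_nat_ge (-(w z).toReal)
      have h1 := (h k).2
      rw [← EReal.coe_toReal htop hb, EReal.coe_lt_coe_iff] at h1
      linarith
  rw [h]
  refine MeasurableSet.iInter fun k => IsOpen.measurableSet ?_
  refine isOpen_iff_mem_nhds.2 fun z hz => ?_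
  have hev := hw z hz.1 _ hz.2
  rw [hV.nhdsWithin_eq hz.1] at hev
  filter_upwards [hev, hV.mem_nhds hz.1] with y h1 h2 using ⟨h2, h1⟩

/-- On every circle about `z₀` in a complex line, the integrable minorant makes `u` finite almost
everywhere; Fubini over rotations does the rest. -/
theorem PSHOn.measure_ball_eq_bot (hu : PSHOn u D) {z₀ : Cn n} {R : ℝ} (hR : ball z₀ R ⊆ D)
    (hb : u z₀ ≠ ⊥) : volume {z ∈ ball z₀ R | u z = ⊥} = 0 := by
  have hm := measurableSet_eq_bot isOpen_ball (hu.1.mono hR)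
  set P := {z ∈ ball z₀ R | u z = ⊥}
  rw [← measure_preimage_add volume z₀,
    measure_eq_zero_iff_ae_ae_circleMap volume (hm.preimage (measurable_const_add z₀))]
  refine ae_of_all _ fun x => ?_
  by_cases hx : z₀ + x ∈ ball z₀ R
  · obtain ⟨g, -, hg, -⟩ := hu.hasSubmean_line hR hx hb
    filter_upwards [hg] with θ hθ hP
    rw [add_sub_cancel_left] at hθ
    have h1 : u (z₀ + circleMap 0 1 θ • x) = ⊥ := hP.2
    rw [h1] at hθ
    exact EReal.coe_ne_bot _ (le_bot_iff.1 hθ)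
  · refine ae_of_all _ fun θ hP => hx ?_
    have h1 : z₀ + circleMap 0 1 θ • x ∈ ball z₀ R := hP.1
    rw [mem_ball, dist_eq_norm, add_sub_cancel_left] at h1 ⊢
    rwa [norm_smul, norm_circleMap_zero, abs_one, one_mul] at h1

theorem PSHOn.measure_eq_bot (hu : PSHOn u D) (hD : IsOpen D) (hc : IsPreconnected D)
    (hne : ∃ z ∈ D, u z ≠ ⊥) : volume {z ∈ D | u z = ⊥} = 0 := by
  set P := {z ∈ D | u z = ⊥} with hP
  set S : Set (Cn n) := {z | ∃ t, IsOpen t ∧ z ∈ t ∧ volume (t ∩ P) = 0} with hS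
  have hSo : IsOpen S := by
    refine isOpen_iff_mem_nhds.2 ?_
    rintro z ⟨t, ht, hzt, h0⟩
    exact mem_of_superset (ht.mem_nhds hzt) fun w hw => ⟨t, ht, hw, h0⟩
  have hball : ∀ z₁ R, ball z₁ R ⊆ D → u z₁ ≠ ⊥ → ball z₁ R ⊆ S := by
    intro z₁ R hR hb w hw
    refine ⟨ball z₁ R, isOpen_ball, hw, measure_mono_null ?_ (hu.measure_ball_eq_bot hR hb)⟩
    exact fun x hx => ⟨hx.1, hx.2.2⟩
  have hDS : D ⊆ S := by
    obtain ⟨z₁, hz₁, hb⟩ := hne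
    obtain ⟨R, hR, hRD⟩ := Metric.isOpen_iff.1 hD z₁ hz₁
    refine hc.subset_of_closure_inter_subset hSo
      ⟨z₁, hz₁, hball z₁ R hRD hb (mem_ball_self hR)⟩ ?_
    rintro z ⟨hz, hzD⟩
    obtain ⟨R, hR, hRD⟩ := Metric.isOpen_iff.1 hD z hzD
    obtain ⟨s, hs, ⟨t, ht, hst, h0⟩⟩ := mem_closure_iff_nhds.1 hz _ (ball_mem_nhds z (half_pos hR))
    have hpos := (ht.inter isOpen_ball).measure_pos volume ⟨s, hst, hs⟩
    -- Positive measure yields a point with `u` finite within `R / 2` of `z`; the ball of radius `R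
    -- / 2` about it then contains `z`, which propagates nullity.
    obtain ⟨z₂, hz₂, hz₂P⟩ : ∃ z₂ ∈ t ∩ ball z (R / 2), z₂ ∉ P := by
      by_contra! hcon
      refine hpos.ne' (measure_mono_null ?_ h0)
      exact fun x hx => ⟨hx.1, hcon x hx⟩
    have hz₂d := mem_ball.1 hz₂.2
    have hsub : ball z₂ (R / 2) ⊆ D := (ball_subset_ball' (by linarith)).trans hRD
    have hz₂D : z₂ ∈ D := hsub (mem_ball_self (half_pos hR))
    refine hball z₂ (R / 2) hsub (fun h => hz₂P ⟨hz₂D, h⟩) ?_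
    rwa [mem_ball, dist_comm]
  refine measure_null_of_locally_null P fun z hz => ?_
  obtain ⟨t, ht, hzt, h0⟩ := hDS hz.1
  exact ⟨t ∩ P, inter_mem (mem_nhdsWithin_of_mem_nhds (ht.mem_nhds hzt)) self_mem_nhdsWithin, h0⟩

/-- Near each of its points, `F` lies in the `-∞` set of an almost everywhere finite subharmonic
function. -/
def IsThin (F : Set ℂ) : Prop :=
  ∀ a ∈ F, ∃ O : Set ℂ, IsOpen O ∧ a ∈ O ∧ ∃ W : ℂ → EReal, SubharmonicOn W O ∧
    volume {ζ ∈ O | W ζ = ⊥} = 0 ∧ ∀ ζ ∈ F ∩ O, W ζ = ⊥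

/-- Fubini in `(b, ζ)`: for fixed `ζ ≠ 0` the preimage of a null set under `b ↦ p + ζ b` is null. -/
theorem ae_line_of_null {N : Set (Cn n)} (hNm : MeasurableSet N) (hN : volume N = 0) (p : Cn n) :
    ∀ᵐ b : Cn n, ∀ᵐ ζ : ℂ, p + ζ • b ∉ N := by
  have hm : MeasurableSet {q : Cn n × ℂ | p + q.2 • q.1 ∉ N} := by
    have hcont : Continuous fun q : Cn n × ℂ => p + q.2 • q.1 := by fun_prop
    exact (hcont.measurable hNm).compl
  rw [Measure.ae_ae_comm hm]
  have h0 : ∀ᵐ ζ : ℂ, ζ ≠ 0 := by simp [ae_iff]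
  filter_upwards [h0] with ζ hζ
  rw [ae_iff]
  have h1 := (measure_preimage_smul_eq_zero_iff volume hζ ((fun x => p + x) ⁻¹' N)).2
    (by rwa [measure_preimage_add])
  simpa [preimage] using h1

/-- Countably many of the local functions suffice, by Lindelöf, and the union of their `-∞` sets is
null. Almost every line through `p` meets that union in a null set, so the restrictions to the line
are finite almost everywhere. -/
theorem IsPluripolar.ae_isThin {E : Set (Cn n)} (hE : IsPluripolar E) :
    volume E = 0 ∧ ∀ p, ∀ᵐ b : Cn n, IsThin {ζ : ℂ | p + ζ • b ∈ E} := by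
  choose! V hV haV w hw hne hbot using hE
  obtain ⟨T, hTE, hTc, hTV⟩ : ∃ T ⊆ E, T.Countable ∧ ⋃ a ∈ T, V a = ⋃ a ∈ E, V a :=
    TopologicalSpace.isOpen_biUnion_countable E V fun a ha => (hV a ha).1
  set N := ⋃ a ∈ T, {z ∈ V a | w a z = ⊥}
  have hNm : MeasurableSet N := MeasurableSet.biUnion hTc fun a ha =>
    measurableSet_eq_bot (hV a (hTE ha)).1 (hw a (hTE ha)).1
  have hN : volume N = 0 := (measure_biUnion_null_iff hTc).2 fun a ha =>
    (hw a (hTE ha)).measure_eq_bot (hV a (hTE ha)).1 (hV a (hTE ha)).2.isPreconnected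
      (hne a (hTE ha))
  have hcov : ∀ z ∈ E, ∃ a ∈ T, z ∈ V a := fun z hz => by
    have h : z ∈ ⋃ a ∈ E, V a := mem_biUnion hz (haV z hz)
    rw [← hTV] at h
    simpa using h
  refine ⟨measure_mono_null (fun z hz => ?_) hN, fun p => ?_⟩
  · obtain ⟨a, ha, hza⟩ := hcov z hz
    exact mem_biUnion ha ⟨hza, hbot a (hTE ha) z ⟨hz, hza⟩⟩
  · filter_upwards [ae_line_of_null hNm hN p] with b hb ζ₀ hζ₀
    obtain ⟨a, ha, hza⟩ := hcov _ hζ₀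
    have hline : Continuous fun ζ : ℂ => p + ζ • b := by fun_prop
    refine ⟨{ζ | p + ζ • b ∈ V a}, (hV a (hTE ha)).1.preimage hline, hza, _,
      (hw a (hTE ha)).2.2 p b, ?_, fun ζ hζ => hbot a (hTE ha) _ hζ⟩
    rw [ae_iff] at hb
    refine measure_mono_null (fun ζ hζ => ?_) hb
    simp only [mem_ofPred_eq, not_not]
    exact mem_biUnion ha hζ

end SCV

/-! ### Removing thin singularities and Liouville's theorem -/

namespace SCV
open Filter Topology Metric Real InnerProductSpace

theorem HasSubmean.comp_const_add {s : ℂ → EReal} {c : ℂ} {r : ℝ} (h : HasSubmean s c r) :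
    HasSubmean (fun τ => s (c + τ)) 0 r := by
  have hm : ∀ θ, c + circleMap 0 r θ = circleMap c r θ := fun θ => by simp [circleMap]
  obtain ⟨g, hg, hgs, hc⟩ := h
  refine ⟨fun τ => g (c + τ), ?_, ?_, ?_⟩
  · rw [circleIntegrable_iff_integrableOn] at hg ⊢
    simpa only [hm] using hg
  · simpa only [hm] using hgs
  · rw [circleAverage_eq_setIntegral] at hc ⊢
    simpa only [hm, add_zero] using hc

theorem coe_mul_mono {δ : ℝ} (hδ : 0 ≤ δ) : Monotone fun x : EReal => (δ : EReal) * x :=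
  fun _ _ h => mul_le_mul_of_nonneg_left h (EReal.coe_nonneg.2 hδ)

theorem HasSubmean.add_mul {s w : ℂ → EReal} {c : ℂ} {r δ : ℝ} (hδ : 0 ≤ δ)
    (h : HasSubmean s c r) (hw : HasSubmean w c r) :
    HasSubmean (fun z => s z + δ * w z) c r := by
  obtain ⟨g, hg, hgs, hc⟩ := h
  obtain ⟨g', hg', hgs', hc'⟩ := hw
  have hgi : CircleIntegrable (fun z => δ * g' z) c r := by
    simpa using! hg'.const_smul (a := δ)
  refine ⟨fun z => g z + δ * g' z, hg.add hgi, ?_, ?_⟩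
  · filter_upwards [hgs, hgs'] with θ h1 h2
    rw [EReal.coe_add, EReal.coe_mul]
    exact add_le_add h1 (coe_mul_mono hδ h2)
  · have h3 : circleAverage (fun z => δ * g' z) c r = δ * circleAverage g' c r := by
      simpa using circleAverage_fun_smul (a := δ) (f := g') (c := c) (R := r)
    rw [circleAverage_fun_add hg hgi, h3, EReal.coe_add, EReal.coe_mul]
    exact add_le_add hc (coe_mul_mono hδ hc')

theorem upperSemicontinuousOn_add_mul {X : Type*} [TopologicalSpace X] {s w : X → EReal}
    {K : Set X} {δ : ℝ} (hδ : 0 < δ) (hs : UpperSemicontinuousOn s K)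
    (hw : UpperSemicontinuousOn w K) (hst : ∀ x ∈ K, s x < ⊤) (hwt : ∀ x ∈ K, w x < ⊤) :
    UpperSemicontinuousOn (fun z => s z + δ * w z) K := by
  have hc : Continuous fun x : EReal => (δ : EReal) * x := by
    have h0 : (δ : EReal) ≠ 0 := by exact_mod_cast hδ.ne'
    refine continuous_iff_continuousAt.2 fun x => ContinuousAt.comp (f := fun x : EReal =>
      ((δ : EReal), x)) (g := fun p : EReal × EReal => p.1 * p.2) (EReal.continuousAt_mul
      (Or.inl h0) (Or.inl h0) (Or.inl (EReal.coe_ne_bot δ)) (Or.inl (EReal.coe_ne_top δ)))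
      (by fun_prop)
  refine hs.add' (hc.comp_upperSemicontinuousOn hw (coe_mul_mono hδ.le)) fun x hx => ?_
  have h1 : (δ : EReal) * w x ≠ ⊤ := by
    obtain ⟨M, hM, -⟩ := EReal.lt_iff_exists_real_btwn.1 (hwt x hx)
    refine ((coe_mul_mono hδ.le hM.le).trans_lt ?_).ne
    dsimp only
    rw [← EReal.coe_mul]
    exact EReal.coe_lt_top _
  exact EReal.continuousAt_add (Or.inl (hst x hx).ne) (Or.inr h1)

/-- A function on the complement of the closed set `F`, bounded above by `0`, upper semicontinuous
and subharmonic along affine discs. -/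
structure NonposSubharmonicOff (v : ℂ → EReal) (F : Set ℂ) : Prop where
  isClosed : IsClosed F
  upperSemicontinuousOn : UpperSemicontinuousOn v Fᶜ
  nonpos : ∀ ζ ∉ F, v ζ ≤ 0
  hasSubmean : ∀ (c a : ℂ) (r : ℝ), 0 < r → (∀ τ ∈ closedBall (0 : ℂ) r, c + τ * a ∉ F) →
    v c ≠ ⊥ → HasSubmean (fun τ => v (c + τ * a)) 0 r

/-- The upper limit of `v` along the complement of `F`. -/
noncomputable def limsupOff (v : ℂ → EReal) (F : Set ℂ) (ζ : ℂ) : EReal := limsup v (𝓝[Fᶜ] ζ)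

variable {v : ℂ → EReal} {F : Set ℂ}

theorem limsupOff_eq (hv : NonposSubharmonicOff v F) {ζ : ℂ} (hζ : ζ ∉ F) :
    limsupOff v F ζ = v ζ := by
  refine le_antisymm (UpperSemicontinuousOn.limsup_le hv.upperSemicontinuousOn ζ hζ) ?_
  rw [limsupOff]
  refine le_limsup_of_frequently_le ?_ (by isBoundedDefault)
  rw [frequently_iff]
  intro U hU
  exact ⟨ζ, mem_of_mem_nhdsWithin hζ hU, le_rfl⟩

theorem limsupOff_nonpos (hv : NonposSubharmonicOff v F) (ζ : ℂ) : limsupOff v F ζ ≤ 0 :=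
  limsup_le_of_le (by isBoundedDefault) (by
    filter_upwards [self_mem_nhdsWithin] with x hx using hv.nonpos x hx)

theorem upperSemicontinuous_limsupOff : UpperSemicontinuous (limsupOff v F) := by
  intro ζ c hc
  obtain ⟨c', h1, h2⟩ := exists_between hc
  have hev : ∀ᶠ x in 𝓝[Fᶜ] ζ, v x < c' := eventually_lt_of_limsup_lt h1 (by isBoundedDefault)
  have hev' : ∀ᶠ y in 𝓝 ζ, ∀ᶠ x in 𝓝[Fᶜ] y, v x < c' := by
    filter_upwards [(eventually_nhdsWithin_iff.1 hev).eventually_nhds] with y hy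
    exact eventually_nhdsWithin_iff.2 hy
  filter_upwards [hev'] with y hy
  exact (limsup_le_of_le (by isBoundedDefault) (hy.mono fun x hx => hx.le)).trans_lt h2

theorem NonposSubharmonicOff.noTouch (hv : NonposSubharmonicOff v F) {a : ℂ} (ha : a ∉ F) :
    NoTouch (limsupOff v F) a := by
  intro m hm h hh ε hε hev
  rw [limsupOff_eq hv ha] at hm
  have hFo := hv.isClosed.isOpen_compl
  have hs : ∀ᶠ r in 𝓝[>] (0 : ℝ), HasSubmean (fun τ => v (a + τ)) 0 r := by
    obtain ⟨ρ, hρ, hρF⟩ := Metric.isOpen_iff.1 hFo a ha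
    filter_upwards [Ioo_mem_nhdsGT hρ] with r hr
    have h1 := hv.hasSubmean a 1 r hr.1 (fun τ hτ => hρF (by
      rw [mem_closedBall_zero_iff] at hτ
      rw [mem_ball, dist_eq_norm, add_sub_cancel_left, mul_one]
      exact hτ.trans_lt hr.2)) (by simp [hm])
    simpa using h1
  refine not_eventually_le_of_hasSubmean (m := m) hs (by simpa using hm) (q := fun τ => h (a + τ))
    (harmonicAt_comp_const_add hh) (H := fun _ => (0 : ℂ)) analyticAt_const rfl
    (hasDerivAt_const _ _) 0 hε le_rfl (0 : ℂ) (a := (1 : ℂ)) one_ne_zero ?_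
  have htr : Tendsto (fun τ : ℂ => a + τ) (𝓝 0) (𝓝 a) :=
    Continuous.tendsto' (by fun_prop) _ _ (by simp)
  filter_upwards [htr.eventually hev, htr.eventually (hFo.mem_nhds ha)] with τ h1 h2
  rw [limsupOff_eq hv h2] at h1
  refine h1.trans (EReal.coe_le_coe_iff.2 (le_of_eq ?_))
  simp
  ring

/-- Near every point off `F`, the value of `v` is almost attained outside a given null set. -/
theorem NonposSubharmonicOff.exists_near (hv : NonposSubharmonicOff v F) {y₀ : ℂ} (hy₀ : y₀ ∉ F)
    {t : ℝ} (ht : (t : EReal) < v y₀) {N Q : Set ℂ} (hN : N ∈ 𝓝 y₀) (hQm : MeasurableSet Q)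
    (hQ : volume Q = 0) : ∃ y ∈ N, y ∉ F ∧ y ∉ Q ∧ (t : EReal) < v y := by
  obtain ⟨σ, hσ, hσN⟩ := Metric.mem_nhds_iff.1
    (inter_mem hN (hv.isClosed.isOpen_compl.mem_nhds hy₀))
  have hae := (measure_eq_zero_iff_ae_ae_circleMap volume
    (hQm.preimage (measurable_const_add y₀))).1 (by rwa [measure_preimage_add])
  have hpos : volume (ball (0 : ℂ) σ) ≠ 0 := (measure_ball_pos volume 0 hσ).ne'
  obtain ⟨x, hxσ, hx⟩ : ∃ x ∈ ball (0 : ℂ) σ,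
      ∀ᵐ θ ∂volume.restrict (Ioc 0 (2 * π)), circleMap 0 1 θ • x ∉ (fun y => y₀ + y) ⁻¹' Q := by
    by_contra! hcon
    refine hpos (measure_mono_null ?_ (ae_iff.1 hae))
    exact fun x hx => hcon x hx
  rw [mem_ball_zero_iff] at hxσ
  have hmem : ∀ τ ∈ closedBall (0 : ℂ) 1, y₀ + τ * x ∈ ball y₀ σ := fun τ hτ => by
    rw [mem_closedBall_zero_iff] at hτ
    rw [mem_ball, dist_eq_norm, add_sub_cancel_left, norm_mul]
    exact (mul_le_of_le_one_left (norm_nonneg _) hτ).trans_lt hxσ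
  obtain ⟨g, hg, hgs, hc⟩ := hv.hasSubmean y₀ x 1 one_pos (fun τ hτ => (hσN (hmem τ hτ)).2)
    ((EReal.bot_lt_coe _).trans ht).ne'
  by_contra! hcon
  have h1 : circleAverage g 0 1 ≤ circleAverage (fun _ => t) 0 1 := by
    refine circleAverage_mono_ae hg (circleIntegrable_const _ _ _) ?_
    filter_upwards [hgs, hx] with θ h1 h2
    have h3 := hσN (hmem _ (sphere_subset_closedBall (circleMap_mem_sphere 0 zero_le_one θ)))
    exact EReal.coe_le_coe_iff.1 (h1.trans (hcon _ h3.1 h3.2 h2))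
  rw [circleAverage_const] at h1
  simp only [zero_mul, add_zero] at hc
  exact absurd (hc.trans (EReal.coe_le_coe_iff.2 h1)) (not_le.2 ht)

/-- The upper limit of `v` is subharmonic across the thin set `F`. -/
theorem NonposSubharmonicOff.noTouch_of_mem (hv : NonposSubharmonicOff v F) (hF : IsThin F) {a : ℂ}
    (ha : a ∈ F) : NoTouch (limsupOff v F) a := by
  intro m hm h hh ε hε hev
  obtain ⟨O, hO, haO, W, hW, hW0, hWF⟩ := hF a ha
  obtain ⟨ρ, hρ, hball⟩ := Metric.nhds_basis_closedBall.eventually_iff.1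
    ((hev.and hh.eventually).and (hO.eventually_mem haO))
  have hFo := hv.isClosed.isOpen_compl
  have hhc : ContinuousOn h (closedBall a ρ) := fun ζ hζ =>
    (hball hζ).1.2.1.continuousAt.continuousWithinAt
  have hOsub : closedBall a ρ ⊆ O := fun ζ hζ => (hball hζ).2
  have hWu := hW.1.mono hOsub
  have hWt : ∀ ζ ∈ closedBall a ρ, W ζ < ⊤ := fun ζ hζ => hW.2.1 ζ (hOsub hζ)
  obtain ⟨M, hM⟩ := exists_real_bound (isCompact_closedBall a ρ) hWu hWt
  -- Relative to `m - h a + δ M`, values on the circle drop by at least `4 η`, while the competitor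
  -- `y` drops by less than `3 η`.
  set η := ε * ρ ^ 2 / 8 with hη
  have hη0 : 0 < η := by positivity
  -- a point off `F` where `v` is large and `W` is finite
  have hha : ∀ᶠ y in 𝓝 a, h y < h a + η :=
    hh.1.continuousAt.eventually_lt continuousAt_const (by linarith)
  have hnear : ∀ᶠ y in 𝓝 a, y ∈ ball a ρ ∧ h y < h a + η :=
    (isOpen_ball.eventually_mem (mem_ball_self hρ)).and hha
  have hfreq : ∃ᶠ y in 𝓝[Fᶜ] a, ((m - η : ℝ) : EReal) < v y := by
    refine frequently_lt_of_lt_limsup (by isBoundedDefault) ?_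
    change _ < limsupOff v F a
    rw [hm, EReal.coe_lt_coe_iff]
    linarith
  obtain ⟨y₀, hy₀v, hy₀, hy₀F⟩ := (hfreq.and_eventually ((eventually_nhdsWithin_of_eventually_nhds
    hnear.eventually_nhds).and self_mem_nhdsWithin)).exists
  obtain ⟨y, ⟨hyρ, hyh⟩, hyF, hyQ, hyv⟩ := hv.exists_near hy₀F hy₀v hy₀
    (measurableSet_eq_bot hO hW.1) hW0
  have hyB := ball_subset_closedBall hyρ
  have hyW : W y ≠ ⊥ := fun hb => hyQ ⟨hOsub hyB, hb⟩
  obtain ⟨b, hb⟩ : ∃ b : ℝ, W y = b := ⟨_, (EReal.coe_toReal (hWt y hyB).ne hyW).symm⟩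
  have hbM : b ≤ M := by
    have := hM y hyB
    rwa [hb, EReal.coe_le_coe_iff] at this
  obtain ⟨δ, hδ0, hδ⟩ : ∃ δ > 0, δ * (M - b) < η := by
    refine ⟨η / (M - b + 1), div_pos hη0 (by linarith), ?_⟩
    rw [div_mul_eq_mul_div, div_lt_iff₀ (by linarith)]
    nlinarith
  set T : ℂ → ℝ := fun ζ => -h ζ + ε / 2 * ‖ζ - a‖ ^ 2 with hT
  have hvs : UpperSemicontinuousOn (limsupOff v F) (closedBall a ρ) :=
    upperSemicontinuous_limsupOff.upperSemicontinuousOn _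
  have hvt : ∀ ζ ∈ closedBall a ρ, limsupOff v F ζ < ⊤ := fun ζ _ =>
    (limsupOff_nonpos hv ζ).trans_lt EReal.zero_lt_top
  have hsumt : ∀ ζ ∈ closedBall a ρ, limsupOff v F ζ + δ * W ζ < ⊤ := fun ζ hζ => by
    refine (add_le_add (limsupOff_nonpos hv ζ) (coe_mul_mono hδ0.le (hM ζ hζ))).trans_lt ?_
    rw [zero_add]
    dsimp only
    rw [← EReal.coe_mul]
    exact EReal.coe_lt_top _
  have hylow : ((m - η + δ * b : ℝ) : EReal) < limsupOff v F y + δ * W y := by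
    rw [limsupOff_eq hv hyF, hb, EReal.coe_add, EReal.coe_mul, ← EReal.coe_mul]
    exact EReal.add_lt_add_right_coe hyv _
  obtain ⟨ζ₁, hζ₁, m₁, hm₁, hmax⟩ := exists_max_add (isCompact_closedBall a ρ)
    (upperSemicontinuousOn_add_mul hδ0 hvs hWu hvt hWt) hsumt (T := T)
    (hhc.neg.add (by fun_prop)) hyB ((EReal.bot_lt_coe _).trans hylow).ne'
  have hbig : m - h a - 3 * η + δ * M < m₁ + T ζ₁ := by
    have h1 := hylow.trans_le (hmax y hyB)
    rw [EReal.coe_lt_coe_iff] at h1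
    have h2 : -h y ≤ T y := by
      have : 0 ≤ ε / 2 * ‖y - a‖ ^ 2 := by positivity
      simp only [hT]; linarith
    linarith
  have hvb : limsupOff v F ζ₁ ≠ ⊥ := fun h0 => by
    rw [h0, EReal.bot_add] at hm₁
    exact EReal.coe_ne_bot _ hm₁.symm
  have hWb : W ζ₁ ≠ ⊥ := fun h0 => by
    rw [h0, EReal.coe_mul_bot_of_pos hδ0, EReal.add_bot] at hm₁
    exact EReal.coe_ne_bot _ hm₁.symm
  -- The term `δ W` is `-∞` on `F`, so it drives the maximum off `F`, where the sub-mean inequality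
  -- for `v + δ W` is available.
  have hζ₁F : ζ₁ ∉ F := fun hF1 => hWb (hWF ζ₁ ⟨hF1, hOsub hζ₁⟩)
  have hζ₁ρ : ζ₁ ∈ ball a ρ := by
    refine lt_of_le_of_ne (mem_closedBall.1 hζ₁) fun heq => ?_
    have h1 := add_le_add (hball hζ₁).1.1 (coe_mul_mono hδ0.le (hM ζ₁ hζ₁))
    dsimp only at h1
    rw [hm₁, ← EReal.coe_mul, ← EReal.coe_add, EReal.coe_le_coe_iff] at h1
    rw [dist_eq_norm] at heq
    simp only [hT] at hbig
    rw [heq] at h1 hbig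
    linarith
  have hs : ∀ᶠ r in 𝓝[>] (0 : ℝ),
      HasSubmean (fun τ => v (ζ₁ + τ) + δ * W (ζ₁ + τ)) 0 r := by
    obtain ⟨σ, hσ, hσF⟩ := Metric.isOpen_iff.1 (hFo.inter hO) ζ₁ ⟨hζ₁F, hOsub hζ₁⟩
    filter_upwards [Ioo_mem_nhdsGT hσ] with r hr
    have h1 := hv.hasSubmean ζ₁ 1 r hr.1 (fun τ hτ => (hσF (by
      rw [mem_closedBall_zero_iff] at hτ
      rw [mem_ball, dist_eq_norm, add_sub_cancel_left, mul_one]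
      exact hτ.trans_lt hr.2)).1) (by rwa [← limsupOff_eq hv hζ₁F])
    simp only [mul_one] at h1
    have h2 := hW.hasSubmean hr.1
      (((closedBall_subset_ball hr.2).trans hσF).trans inter_subset_right) hWb
    exact h1.add_mul hδ0.le h2.comp_const_add
  refine not_eventually_le_of_hasSubmean (m := m₁) hs
    (by simpa [limsupOff_eq hv hζ₁F] using hm₁) (q := fun τ => h (ζ₁ + τ))
    (harmonicAt_comp_const_add (hball hζ₁).1.2) (H := fun _ => (0 : ℂ)) analyticAt_const rfl
    (hasDerivAt_const _ _) 0 (half_pos hε) le_rfl (ζ₁ - a) (a := (1 : ℂ)) one_ne_zero ?_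
  have htr : Tendsto (fun τ : ℂ => ζ₁ + τ) (𝓝 0) (𝓝 ζ₁) :=
    Continuous.tendsto' (by fun_prop) _ _ (by simp)
  filter_upwards [htr.eventually (hFo.mem_nhds hζ₁F),
    htr.eventually (isOpen_ball.mem_nhds hζ₁ρ)] with τ h1 h2
  have h3 := hmax _ (ball_subset_closedBall h2)
  rw [limsupOff_eq hv h1] at h3
  refine h3.trans (EReal.coe_le_coe_iff.2 (le_of_eq ?_))
  have h4 : ζ₁ - a + τ • (1 : ℂ) = ζ₁ + τ - a := by rw [smul_eq_mul]; ring
  simp only [hT, add_zero]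
  rw [h4]
  ring

/-- Liouville's theorem for nonpositive subharmonic functions off a thin set. -/
theorem NonposSubharmonicOff.eq (hv : NonposSubharmonicOff v F) (hF : IsThin F) {z₁ z₂ : ℂ}
    (hz₁ : z₁ ∉ F) (hz₂ : z₂ ∉ F) : v z₁ = v z₂ := by
  have hNT : ∀ a, NoTouch (limsupOff v F) a := fun a => by
    by_cases ha : a ∈ F
    · exact hv.noTouch_of_mem hF ha
    · exact hv.noTouch ha
  have key : ∀ z₁ z₂, z₁ ∉ F → z₂ ∉ F → v z₂ ≤ v z₁ := by
    intro z₁ z₂ hz₁ hz₂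
    by_contra! hlt
    obtain ⟨m', hm1, hm2⟩ := EReal.lt_iff_exists_real_btwn.1 hlt
    obtain ⟨x, hx1, hx2⟩ := EReal.lt_iff_exists_real_btwn.1 hm2
    rw [EReal.coe_lt_coe_iff] at hx1
    rw [← limsupOff_eq hv hz₁] at hm1
    rw [← limsupOff_eq hv hz₂] at hx2
    obtain ⟨r, hr, hrv⟩ := Metric.nhds_basis_closedBall.eventually_iff.1
      (upperSemicontinuous_limsupOff z₁ _ hm1)
    have hdist : r < ‖z₂ - z₁‖ := by
      by_contra! hle
      have h1 := hrv (x := z₂) (by rwa [mem_closedBall, dist_eq_norm])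
      have h2 := hx2.trans h1
      rw [EReal.coe_lt_coe_iff] at h2
      linarith
    set κ := x - m' with hκ
    have hκ0 : 0 < κ := sub_pos.2 hx1
    set l := Real.log (‖z₂ - z₁‖ / r) with hl
    have hl0 : 0 < l := Real.log_pos ((one_lt_div hr).2 hdist)
    set δ := κ / 4 / l with hδ
    have hδ0 : 0 < δ := by positivity
    have hδl : δ * l = κ / 4 := by rw [hδ]; field_simp
    -- Comparison with a small multiple of the logarithm on an annulus: on the outer circle only `v
    -- ≤ 0` is known, and `R` is so large that the logarithm alone brings the sum below `m'`. The
    -- `ε` term supplies strictness.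
    obtain ⟨R, hRz, hRm⟩ : ∃ R, ‖z₂ - z₁‖ < R ∧ -δ * Real.log (R / r) ≤ m' := by
      refine ⟨max (‖z₂ - z₁‖ + 1) (r * Real.exp (-m' / δ)), (lt_add_one _).trans_le
        (le_max_left _ _), ?_⟩
      have h1 : Real.exp (-m' / δ) ≤ max (‖z₂ - z₁‖ + 1) (r * Real.exp (-m' / δ)) / r := by
        rw [le_div_iff₀ hr, mul_comm]
        exact le_max_right _ _
      have h2 := Real.log_le_log (exp_pos _) h1
      rw [Real.log_exp, div_le_iff₀ hδ0] at h2
      linarith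
    have hR0 : 0 < R := (norm_nonneg _).trans_lt hRz
    obtain ⟨ε, hε0, hε⟩ : ∃ ε > 0, ε * R ^ 2 < κ / 4 := by
      refine ⟨κ / 8 / R ^ 2, by positivity, ?_⟩
      rw [div_mul_cancel₀ _ (by positivity)]
      linarith
    set T : ℂ → ℝ := fun ζ => -δ * Real.log (‖ζ - z₁‖ / r) + ε * ‖ζ - z₁‖ ^ 2 with hT
    set K := closedBall z₁ R ∩ (ball z₁ r)ᶜ with hK
    have hKc : IsCompact K := (isCompact_closedBall z₁ R).inter_right isOpen_ball.isClosed_compl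
    have hKr : ∀ ζ ∈ K, r ≤ ‖ζ - z₁‖ := fun ζ hζ => by
      have := hζ.2
      rwa [mem_compl_iff, mem_ball, dist_eq_norm, not_lt] at this
    have hTc : ContinuousOn T K := by
      refine (continuousOn_const.mul (ContinuousOn.log (by fun_prop) fun ζ hζ => ?_)).add
        (by fun_prop)
      have := hr.trans_le (hKr ζ hζ)
      positivity
    have hz₂K : z₂ ∈ K := by
      refine ⟨?_, ?_⟩
      · rw [mem_closedBall, dist_eq_norm]; exact hRz.le
      · rw [mem_compl_iff, mem_ball, dist_eq_norm, not_lt]; exact hdist.le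
    obtain ⟨a, haK, m₁, hm₁, hmax⟩ := exists_max_add hKc
      (upperSemicontinuous_limsupOff.upperSemicontinuousOn K)
      (fun ζ _ => (limsupOff_nonpos hv ζ).trans_lt EReal.zero_lt_top) hTc hz₂K
      ((EReal.bot_lt_coe _).trans hx2).ne'
    have hbig : m' + κ / 2 < m₁ + T a := by
      have h1 := hx2.trans_le (hmax z₂ hz₂K)
      rw [EReal.coe_lt_coe_iff] at h1
      have h2 : -(κ / 4) ≤ T z₂ := by
        have : 0 ≤ ε * ‖z₂ - z₁‖ ^ 2 := by positivity
        simp only [hT]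
        rw [← hl]
        linarith
      linarith
    have har : r < ‖a - z₁‖ := by
      refine lt_of_le_of_ne (hKr a haK) fun heq => ?_
      have h1 := hrv (x := a) (by rw [mem_closedBall, dist_eq_norm, ← heq])
      change limsupOff v F a < _ at h1
      rw [hm₁, EReal.coe_lt_coe_iff] at h1
      simp only [hT] at hbig
      rw [← heq, div_self hr.ne', Real.log_one] at hbig
      have h2 : ε * r ^ 2 ≤ ε * R ^ 2 := by
        have := (hdist.trans hRz).le
        gcongr
      linarith
    have haR : ‖a - z₁‖ < R := by
      have h0 := haK.1
      rw [mem_closedBall, dist_eq_norm] at h0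
      refine lt_of_le_of_ne h0 fun heq => ?_
      have h1 := limsupOff_nonpos hv a
      rw [hm₁, ← EReal.coe_zero, EReal.coe_le_coe_iff] at h1
      simp only [hT] at hbig
      rw [heq] at hbig
      linarith
    have hlog : HarmonicAt (fun ζ : ℂ => Real.log ‖(ζ - z₁) / r‖) a := by
      refine AnalyticAt.harmonicAt_log_norm (by fun_prop) ?_
      refine div_ne_zero (fun h0 => ?_) (by exact_mod_cast hr.ne')
      rw [h0, norm_zero] at har
      linarith
    refine (hNT a).not_eventually_le hm₁ (hlog.const_smul (c := δ)) hε0 z₁ ?_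
    have hev : ∀ᶠ ζ in 𝓝 a, ζ ∈ K := by
      have h1 : ∀ᶠ ζ in 𝓝 a, r < ‖ζ - z₁‖ :=
        continuousAt_const.eventually_lt (by fun_prop) har
      have h2 : ∀ᶠ ζ in 𝓝 a, ‖ζ - z₁‖ < R :=
        ContinuousAt.eventually_lt (by fun_prop) continuousAt_const haR
      filter_upwards [h1, h2] with ζ h3 h4
      refine ⟨?_, ?_⟩
      · rw [mem_closedBall, dist_eq_norm]; exact h4.le
      · rw [mem_compl_iff, mem_ball, dist_eq_norm, not_lt]; exact h3.le
    filter_upwards [hev] with ζ hζ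
    refine (hmax ζ hζ).trans (EReal.coe_le_coe_iff.2 (le_of_eq ?_))
    simp only [hT, Pi.smul_apply, smul_eq_mul, norm_div, Complex.norm_real, norm_of_nonneg hr.le]
    ring
  exact le_antisymm (key z₂ z₁ hz₂ hz₁) (key z₁ z₂ hz₁ hz₂)

end SCV

/-! ### Applications of Liouville's theorem to proper maps -/

namespace SCV
open Filter Topology Metric Real InnerProductSpace

variable {n : ℕ} {f : Cn n → Cn n} {D G X : Set (Cn n)} {u : Cn n → EReal}

theorem SubharmonicOn.mono {s : ℂ → EReal} {U V : Set ℂ} (h : SubharmonicOn s V) (hUV : U ⊆ V) :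
    SubharmonicOn s U :=
  ⟨h.1.mono hUV, fun z hz => h.2.1 z (hUV hz), fun c r hr hc => h.2.2 c r hr (hc.trans hUV)⟩

theorem PSHOn.mono (h : PSHOn u G) (hDG : D ⊆ G) : PSHOn u D :=
  ⟨h.1.mono hDG, fun z hz => h.2.1 z (hDG hz), fun a b => (h.2.2 a b).mono fun _ hζ => hDG hζ⟩

theorem fibreSup_id {w : Cn n} (hw : w ∈ D) : fibreSup (fun z => z) D u w = u w := by
  refine le_antisymm (sSup_le ?_) (le_fibreSup (f := fun z => z) hw)
  rintro _ ⟨x, ⟨-, rfl⟩, rfl⟩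
  exact le_rfl

theorem fibreSup_nonpos (hu0 : ∀ z ∈ D, u z ≤ 0) (w : Cn n) : fibreSup f D u w ≤ 0 := by
  refine sSup_le ?_
  rintro _ ⟨x, hx, rfl⟩
  exact hu0 x hx.1

theorem ProperOn.not_eventually_jac_eq_zero (hf : ProperOn f D G) (hG : IsOpen G)
    (hD : IsConnected D) : ∀ z ∈ D, ¬ ∀ᶠ w in 𝓝 z, jac f w = 0 := by
  obtain ⟨z₁, hz₁, hJ⟩ := hf.exists_jac_ne_zero hG hD.nonempty
  exact fun z hz =>
    SCV.not_eventually_jac_eq_zero hf.isOpen hD.isPreconnected hf.differentiableOn hz₁ hJ hz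

theorem ProperOn.nonposSubharmonicOff (hf : ProperOn f D X) (hX : IsOpen X) (hD : IsConnected D)
    (hu : PSHOn u D) (hu0 : ∀ z ∈ D, u z ≤ 0) {ψ : ℂ → Cn n} {F : Set ℂ} (hF : IsClosed F)
    (hψ : DifferentiableOn ℂ ψ Fᶜ) (hψX : MapsTo ψ Fᶜ X) :
    NonposSubharmonicOff (fun ζ => fibreSup f D u (ψ ζ)) F where
  isClosed := hF
  upperSemicontinuousOn := (hf.upperSemicontinuousOn_fibreSup hX hu.1).comp hψ.continuousOn hψX
  nonpos ζ _ := fibreSup_nonpos hu0 _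
  hasSubmean c a r hr hF' hb := by
    have hline : Continuous fun τ : ℂ => c + τ * a := by fun_prop
    refine hf.hasSubmean_fibreSup hX (hf.not_eventually_jac_eq_zero hX hD) hu
      (ψ := fun τ => ψ (c + τ * a)) (hF.isOpen_compl.preimage hline)
      (hψ.comp (by fun_prop) fun τ hτ => hτ) (fun τ hτ => hψX hτ) hr (fun τ hτ => hF' τ hτ) ?_
    simpa using hb

/-- Liouville's theorem on the complement of a pluripolar set. -/
theorem ProperOn.fibreSup_eq_of_isPluripolar (hf : ProperOn f D X) (hX : IsOpen X)
    (hD : IsConnected D) (hu : PSHOn u D) (hu0 : ∀ z ∈ D, u z ≤ 0) {E : Set (Cn n)}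
    (hE : IsPluripolar E) (hEo : IsOpen Eᶜ) {φ : Cn n → Cn n} (hφ : DifferentiableOn ℂ φ Eᶜ)
    (hφX : MapsTo φ Eᶜ X) {p p' : Cn n} (hp : p ∈ Eᶜ) (hp' : p' ∈ Eᶜ) :
    fibreSup f D u (φ p) = fibreSup f D u (φ p') := by
  obtain ⟨hE0, hthin⟩ := hE.ae_isThin
  have key : ∀ p ∈ Eᶜ, ∀ᵐ q : Cn n, q ∈ Eᶜ → fibreSup f D u (φ p) = fibreSup f D u (φ q) := by
    intro p hp
    -- Translation turns almost every direction `b` into almost every endpoint `q = p + b`, which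
    -- the line reaches at `ζ = 1`.
    have h1 := (measurePreserving_add_left volume (-p)).quasiMeasurePreserving.ae (hthin p)
    filter_upwards [h1] with q hq hqE
    have hline : Continuous fun ζ : ℂ => p + ζ • (-p + q) := by fun_prop
    have hv := hf.nonposSubharmonicOff hX hD hu hu0 (ψ := fun ζ => φ (p + ζ • (-p + q)))
      (F := {ζ : ℂ | p + ζ • (-p + q) ∈ E}) (isOpen_compl_iff.1 (hEo.preimage hline))
      (hφ.comp (by fun_prop) fun τ hτ => hτ) (fun τ hτ => hφX hτ)
    simpa using hv.eq hq (z₁ := 0) (z₂ := 1) (by simpa using hp) (by simpa using hqE)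
  have hEae : ∀ᵐ q : Cn n, q ∈ Eᶜ := by simpa [ae_iff] using hE0
  obtain ⟨q, h1, h2, h3⟩ := ((key p hp).and ((key p' hp').and hEae)).exists
  exact (h1 h3).trans (h2 h3).symm

/-- An entire curve in the target of a proper map from a hyperconvex set lies in a compact set. -/
theorem ProperOn.exists_isCompact_of_isHyperconvex (hf : ProperOn f D X) (hX : IsOpen X)
    (hXc : IsPreconnected X) (hDc : IsConnected D) (hD : IsHyperconvex D) {ψ : ℂ → Cn n}
    (hψ : Differentiable ℂ ψ) (hψX : ∀ ζ, ψ ζ ∈ X) : ∃ K ⊆ X, IsCompact K ∧ ∀ ζ, ψ ζ ∈ K := by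
  obtain ⟨u, hu, hu0, hK⟩ := hD
  have hv := hf.nonposSubharmonicOff hX hDc hu (fun z hz => (hu0 z hz).le) (F := ∅) isClosed_empty
    hψ.differentiableOn (fun ζ _ => hψX ζ)
  have hthin : IsThin ∅ := fun _ h => h.elim
  have hsurj := hf.surjOn hX hXc hDc.nonempty (hf.not_eventually_jac_eq_zero hX hDc)
  have hatt : ∀ ζ, ∃ z ∈ D, f z = ψ ζ ∧ u z = fibreSup f D u (ψ 0) := fun ζ => by
    obtain ⟨z, hz, h1, h2⟩ := hf.exists_eq_fibreSup hu.1 (hψX ζ) (hsurj (hψX ζ))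
    exact ⟨z, hz, h1, h2.trans (hv.eq hthin (notMem_empty _) (notMem_empty _))⟩
  obtain ⟨z, hz, -, h2⟩ := hatt 0
  -- The constant value is attained in `D`, hence strictly negative, which leaves room for a level
  -- `c < 0` above it.
  obtain ⟨c, hc1, hc2⟩ := EReal.lt_iff_exists_real_btwn.1 (h2 ▸ hu0 z hz)
  obtain ⟨K, hKc, hKD, hKu⟩ := hK c (by exact_mod_cast hc2)
  refine ⟨f '' K, (hf.mapsTo.mono_left hKD).image_subset,
    hKc.image_of_continuousOn (hf.differentiableOn.continuousOn.mono hKD), fun ζ => ?_⟩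
  obtain ⟨x, hx, h3, h4⟩ := hatt ζ
  exact ⟨x, hKu ⟨hx, by rw [h4]; exact hc1⟩, h3⟩

theorem isBrodyHyperbolic_of_exists_isCompact
    (h : ∀ ψ : ℂ → Cn n, Differentiable ℂ ψ → (∀ ζ, ψ ζ ∈ G) → ∃ K, IsCompact K ∧ ∀ ζ, ψ ζ ∈ K) :
    IsBrodyHyperbolic G := fun ψ hψ hψG ζ ξ => by
  obtain ⟨K, hK, hψK⟩ := h ψ hψ hψG
  exact hψ.apply_eq_apply_of_bounded (hK.isBounded.subset (range_subset_iff.2 hψK)) ζ ξ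

end SCV

theorem proposition8 (n : ℕ) (D G : Set (SCV.Cn n))
    (hD : SCV.IsCnDomain D) (hG : SCV.IsCnDomain G) :
    (∀ (D' : Set (SCV.Cn n)) (u : SCV.Cn n → EReal) (E : Set (SCV.Cn n)),
      SCV.IsCnDomain D' → SCV.PSHOn u D' → D ⊆ {z ∈ D' | u z < 0} →
      (∃ z ∈ D, ∃ w ∈ D, u z ≠ u w) →
      SCV.IsPluripolar E → G = Eᶜ →
        (¬ ∃ f : SCV.Cn n → SCV.Cn n, SCV.IsProperHolomorphic f D G) ∧
        (¬ ∃ g : SCV.Cn n → SCV.Cn n, SCV.IsProperHolomorphic g G D)) ∧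
    (SCV.IsHyperconvex D → ¬ SCV.IsBrodyHyperbolic G →
        (¬ ∃ f : SCV.Cn n → SCV.Cn n, SCV.IsProperHolomorphic f D G) ∧
        (¬ ∃ g : SCV.Cn n → SCV.Cn n, SCV.IsProperHolomorphic g G D)) := by
  refine ⟨fun D' u E _ hu' hDD' hne hE hGE => ?_, fun hyp hbrody => ?_⟩
  · have hu : SCV.PSHOn u D := hu'.mono fun z hz => (hDD' hz).1
    have hu0 : ∀ z ∈ D, u z ≤ 0 := fun z hz => (hDD' hz).2.le
    obtain ⟨a, ha, b, hb, hab⟩ := hne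
    subst hGE
    constructor
    · rintro ⟨f, hf⟩
      replace hf := hf.properOn hD.1
      obtain ⟨z₀, hz₀, -, h0⟩ := hf.exists_eq_fibreSup hu.1 (hf.mapsTo ha) ⟨a, ha, rfl⟩
      -- A maximiser on the fibre through `a` is a global maximiser, because the fibre supremum
      -- takes the same value at every `f z`.
      have hmax := hu.eq_of_le hD.1 hD.2.isPreconnected hz₀ fun z hz => by
        rw [h0, hf.fibreSup_eq_of_isPluripolar hG.1 hD.2 hu hu0 hE hG.1 (φ := fun z => z)
          differentiableOn_id (mapsTo_id _) (hf.mapsTo ha) (hf.mapsTo hz)]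
        exact SCV.le_fibreSup hz
      exact hab ((hmax a ha).trans (hmax b hb).symm)
    · rintro ⟨g, hg⟩
      replace hg := hg.properOn hG.1
      have hsurj := hg.surjOn hD.1 hD.2.isPreconnected hG.2.nonempty
        (hg.not_eventually_jac_eq_zero hD.1 hG.2)
      obtain ⟨p, hp, rfl⟩ := hsurj ha
      obtain ⟨q, hq, rfl⟩ := hsurj hb
      have h := (SCV.ProperOn.id hD.1).fibreSup_eq_of_isPluripolar hD.1 hD.2 hu hu0 hE hG.1
        hg.differentiableOn hg.mapsTo hp hq
      rw [SCV.fibreSup_id ha, SCV.fibreSup_id hb] at h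
      exact hab h
  · constructor
    · rintro ⟨f, hf⟩
      replace hf := hf.properOn hD.1
      refine hbrody (SCV.isBrodyHyperbolic_of_exists_isCompact fun ψ hψ hψG => ?_)
      obtain ⟨K, -, hK⟩ := hf.exists_isCompact_of_isHyperconvex hG.1 hG.2.isPreconnected hD.2 hyp
        hψ hψG
      exact ⟨K, hK⟩
    · rintro ⟨g, hg⟩
      replace hg := hg.properOn hG.1
      refine hbrody (SCV.isBrodyHyperbolic_of_exists_isCompact fun ψ hψ hψG => ?_)
      have hgψ : Differentiable ℂ fun ζ => g (ψ ζ) := fun ζ =>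
        (hg.differentiableOn.differentiableAt (hG.1.mem_nhds (hψG ζ))).comp ζ (hψ ζ)
      obtain ⟨K, hKD, hK, hψK⟩ := (SCV.ProperOn.id hD.1).exists_isCompact_of_isHyperconvex hD.1
        hD.2.isPreconnected hD.2 hyp hgψ fun ζ => hg.mapsTo (hψG ζ)
      exact ⟨_, hg.isCompact_preimage K hKD hK, fun ζ => ⟨hψG ζ, hψK ζ⟩⟩
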